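/- Let $0<\varepsilon<1$, $\Lambda=[1-\varepsilon,1+\varepsilon]$, and let $\bar\rho=(\rho_0,\rho_1,\dots)$ be a sequence in $(0,1)$ for which there is $s<1$ with $(1+\varepsilon)\rho_n\le s$ for all $n\ge 0$. Let $m$ be a Borel probability measure on $\Lambda$, absolutely continuous with respect to Lebesgue measure, and let $\theta:\Lambda\to\Lambda$ be an invertible, bimeasurable map which preserves $m$ and is ergodic. Let $E=\{1,2,\dots\}$, let $(\nu_1,\nu_2,\dots)$ be a probability vector with $-\sum_{i\ge1}\nu_i\log\nu_i<\infty$ (with $0\log 0=0$), let $\nu$ be the Bernoulli measure on $E^\infty$ with $\nu([i])=\nu_i$, and put $\mu=m\times\nu$; let $(\mu_\lambda)_{\lambda\in\Lambda}$ be the disintegration of $\mu$ over $\Lambda$ (so $\mu_\lambda=\nu$ for $m$-a.e. $\lambda$). For $\lambda\in\Lambda$ and $n\ge0$ let $$\varphi^\lambda_{2n+1}(x)=\lambda\rho_n x+1,\qquad \varphi^\lambda_{2n+2}(x)=\lambda\rho_n x-1,$$ let $X\subset\mathbb R$ be a non-degenerate compact interval mapped into itself by all these maps, and for $\omega\in E^\infty$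 let $\pi_\lambda(\omega)$ be the unique point of $$\bigcap_{n\ge1}\varphi^{\lambda}_{\omega_1}\circ\varphi^{\theta(\lambda)}_{\omega_2}\circ\dots\circ\varphi^{\theta^{n-1}(\lambda)}_{\omega_n}(X).$$ Then for $\mu$-almost every $(\lambda,\omega)\in\Lambda\times E^\infty$ the pointwise dimension $$d_{\mu_\lambda\circ\pi_\lambda^{-1}}(\pi_\lambda(\omega))=\lim_{r\to0^+}\frac{\log \mu_\lambda\circ\pi_\lambda^{-1}\big(B(\pi_\lambda(\omega),r)\big)}{\log r}$$ exists, the Hausdorff dimension $HD(\mu_\lambda\circ\pi_\lambda^{-1})$ is defined (that is, for $\kappa=\mu_\lambda\circ\pi_\lambda^{-1}$ the numbers $\inf\{HD(Y):\kappa(Y)>0\}$ and $\inf\{HD(Y):\kappa(\mathbb R\setminus Y)=0\}$, over Borel sets $Y$, coincide and $HD(\kappa)$ is their common value), and $$d_{\mu_\lambda\circ\pi_\lambda^{-1}}(\pi_\lambda(\omega))=HD(\mu_\lambda\circ\pi_\lambda^{-1})\le\frac{h(m)-\sum_{i\ge1}\nu_i\log\nu_i}{-\int_\Lambda\log\lambda\,dm(\lambda)-\sum_{i\ge0}(\nu_{2i+1}+\nu_{2i+2})\log\rho_i},$$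 where $h(m)\in[0,\infty]$ is the measure-theoretic entropy of $\theta$ with respect to $m$. The denominator lies in $(0,\infty]$; if it is $\infty$, the right-hand side is read as $0$. -/

import Mathlib

open MeasureTheory Filter Topology Set
open scoped ENNReal

/-! ## Random countable iterated function systems and their coding maps -/

section RandomIFS

variable {Λ E : Type*}

/-- The randomized composition along the first `n` letters of `ω = (ω₁, ω₂, …)` (stored as
`ω 0, ω 1, …`), that is
`φ_{ω₁}^l ∘ φ_{ω₂}^{θ l} ∘ ⋯ ∘ φ_{ωₙ}^{θ^{n-1} l}`. -/
def randComp (θ : Λ → Λ) (φ : E → Λ → ℝ → ℝ) : ℕ → Λ → (ℕ → E) → ℝ → ℝ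
  | 0, _, _ => id
  | n + 1, l, ω => φ (ω 0) l ∘ randComp θ φ n (θ l) (fun k => ω (k + 1))

/-- The coding map: `codingMap θ φ X l ω` is the unique point of
`⋂_{n ≥ 1} φ_{ω|n}^l (X)`. (The supremum of a singleton is its point; that the intersection is
a singleton for uniformly contracting maps is `iInter_image_randComp`.) -/
noncomputable def codingMap (θ : Λ → Λ) (φ : E → Λ → ℝ → ℝ) (X : Set ℝ) (l : Λ) (ω : ℕ → E) : ℝ :=
  sSup (⋂ n : ℕ, randComp θ φ (n + 1) l ω '' X)

theorem mapsTo_randComp (θ : Λ → Λ) (φ : E → Λ → ℝ → ℝ) {X : Set ℝ}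
    (hX : ∀ e l, MapsTo (φ e l) X X) :
    ∀ (n : ℕ) (l : Λ) (ω : ℕ → E), MapsTo (randComp θ φ n l ω) X X := by
  intro n
  induction n with
  | zero => intro l ω x hx; exact hx
  | succ n ih => intro l ω x hx; exact hX _ _ (ih _ _ hx)

theorem randComp_contract (θ : Λ → Λ) (φ : E → Λ → ℝ → ℝ) {X : Set ℝ} {s : ℝ}
    (hs : 0 ≤ s) (hX : ∀ e l, MapsTo (φ e l) X X)
    (hφ : ∀ e l, ∀ x ∈ X, ∀ y ∈ X, |φ e l x - φ e l y| ≤ s * |x - y|) :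
    ∀ (n : ℕ) (l : Λ) (ω : ℕ → E), ∀ x ∈ X, ∀ y ∈ X,
      |randComp θ φ n l ω x - randComp θ φ n l ω y| ≤ s ^ n * |x - y| := by
  intro n
  induction n with
  | zero => intro l ω x _ y _; simp [randComp]
  | succ n ih =>
    intro l ω x hx y hy
    have h1 := hφ (ω 0) l _ (mapsTo_randComp θ φ hX n (θ l) (fun k => ω (k + 1)) hx)
      _ (mapsTo_randComp θ φ hX n (θ l) (fun k => ω (k + 1)) hy)
    have h2 := mul_le_mul_of_nonneg_left (ih (θ l) (fun k => ω (k + 1)) x hx y hy) hs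
    calc _ ≤ _ := h1
      _ ≤ _ := h2
      _ = _ := by ring

theorem image_randComp_succ_subset (θ : Λ → Λ) (φ : E → Λ → ℝ → ℝ) {X : Set ℝ}
    (hX : ∀ e l, MapsTo (φ e l) X X) :
    ∀ (n : ℕ) (l : Λ) (ω : ℕ → E), randComp θ φ (n + 1) l ω '' X ⊆ randComp θ φ n l ω '' X := by
  intro n
  induction n with
  | zero =>
    rintro l ω _ ⟨x, hx, rfl⟩
    exact ⟨_, hX (ω 0) l hx, rfl⟩
  | succ n ih =>
    rintro l ω _ ⟨x, hx, rfl⟩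
    obtain ⟨y, hy, hxy⟩ := ih (θ l) (fun k => ω (k + 1)) ⟨x, hx, rfl⟩
    exact ⟨y, hy, congrArg (φ (ω 0) l) hxy⟩

/-- For uniformly contracting maps of a nonempty compact set, the defining intersection of the
coding map is a single point, so `codingMap` is the usual coding map. -/
theorem iInter_image_randComp (θ : Λ → Λ) (φ : E → Λ → ℝ → ℝ) {X : Set ℝ} {s : ℝ}
    (hs : 0 ≤ s) (hs1 : s < 1) (hXc : IsCompact X) (hXn : X.Nonempty)
    (hX : ∀ e l, MapsTo (φ e l) X X)
    (hφ : ∀ e l, ∀ x ∈ X, ∀ y ∈ X, |φ e l x - φ e l y| ≤ s * |x - y|) (l : Λ) (ω : ℕ → E) :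
    ⋂ n : ℕ, randComp θ φ (n + 1) l ω '' X = {codingMap θ φ X l ω} := by
  have hcomp : ∀ n, IsCompact (randComp θ φ n l ω '' X) := by
    intro n
    refine hXc.image_of_continuousOn ?_
    have : LipschitzOnWith (Real.toNNReal (s ^ n)) (randComp θ φ n l ω) X := by
      refine LipschitzOnWith.of_dist_le_mul fun x hx y hy => ?_
      rw [Real.dist_eq, Real.dist_eq, Real.coe_toNNReal _ (by positivity)]
      exact randComp_contract θ φ hs hX hφ n l ω x hx y hy
    exact this.continuousOn
  have hne : (⋂ n : ℕ, randComp θ φ (n + 1) l ω '' X).Nonempty :=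
    IsCompact.nonempty_iInter_of_sequence_nonempty_isCompact_isClosed _
      (fun n => image_randComp_succ_subset θ φ hX (n + 1) l ω) (fun n => hXn.image _)
      (hcomp 1) (fun n => (hcomp (n + 1)).isClosed)
  have hsub : (⋂ n : ℕ, randComp θ φ (n + 1) l ω '' X).Subsingleton := by
    intro u hu v hv
    rw [mem_iInter] at hu hv
    have hb : ∀ n : ℕ, |u - v| ≤ s ^ (n + 1) * Metric.diam X := by
      intro n
      obtain ⟨x, hx, rfl⟩ := hu n
      obtain ⟨y, hy, rfl⟩ := hv n
      refine (randComp_contract θ φ hs hX hφ (n + 1) l ω x hx y hy).trans ?_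
      refine mul_le_mul_of_nonneg_left ?_ (by positivity)
      rw [← Real.dist_eq]
      exact Metric.dist_le_diam_of_mem hXc.isBounded hx hy
    have hlim : Tendsto (fun n : ℕ => s ^ (n + 1) * Metric.diam X) atTop (𝓝 (0 * Metric.diam X)) :=
      (((tendsto_pow_atTop_nhds_zero_of_lt_one hs hs1).comp (tendsto_add_atTop_nat 1))).mul_const _
    have h0 : |u - v| ≤ 0 := by
      have := ge_of_tendsto' hlim hb
      simpa using this
    exact sub_eq_zero.mp (abs_nonpos_iff.mp h0)
  obtain ⟨z, hz⟩ := hne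
  have hzs := hsub.eq_singleton_of_mem hz
  rw [codingMap, hzs, csSup_singleton]

end RandomIFS

/-- The maps of the system on the parameter interval `[1 - ε, 1 + ε]`: the letters `1, 2, 3, …` are
stored as `0, 1, 2, …`, so that the letters `2n` and `2n + 1` stored here are the letters `2n + 1` and
`2n + 2`, with maps `x ↦ l ρ_n x + 1` and `x ↦ l ρ_n x - 1`. -/
def pmMap {ε : ℝ} (ρ : ℕ → ℝ) (e : ℕ) (l : Icc (1 - ε) (1 + ε)) (x : ℝ) : ℝ :=
  (l : ℝ) * ρ (e / 2) * x + (-1) ^ e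

theorem pmMap_even {ε : ℝ} (ρ : ℕ → ℝ) (n : ℕ) (l : Icc (1 - ε) (1 + ε)) (x : ℝ) :
    pmMap ρ (2 * n) l x = (l : ℝ) * ρ n * x + 1 := by
  simp [pmMap]

theorem pmMap_odd {ε : ℝ} (ρ : ℕ → ℝ) (n : ℕ) (l : Icc (1 - ε) (1 + ε)) (x : ℝ) :
    pmMap ρ (2 * n + 1) l x = (l : ℝ) * ρ n * x - 1 := by
  have h : (2 * n + 1) / 2 = n := by omega
  simp [pmMap, h, pow_succ, sub_eq_add_neg]

/-! ## Bernoulli measure and measure-theoretic entropy -/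

/-- The one-sided Bernoulli measure on `ℕ^ℕ` whose coordinates are independent with law `p`. -/
noncomputable def bernoulliMeasure (p : PMF ℕ) : Measure (ℕ → ℕ) :=
  Measure.infinitePi (fun _ : ℕ => p.toMeasure)

section Entropy

variable {α : Type*} [MeasurableSpace α]

/-- Shannon entropy `-∑ μ(A) log μ(A)` of the finite partition `{f = i}`. -/
noncomputable def partitionEntropy {ι : Type*} [Fintype ι] (μ : Measure α) (f : α → ι) : ℝ :=
  ∑ i, Real.negMulLog (μ.real (f ⁻¹' {i}))

/-- If `f` labels the partition `P`, this labels the join `P ∨ T⁻¹P ∨ ⋯ ∨ T^{-(n-1)}P`. -/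
def joinLabel {ι : Type*} (T : α → α) (f : α → ι) (n : ℕ) (x : α) : Fin n → ι :=
  fun j => f (T^[j] x)

/-- The measure-theoretic (Kolmogorov–Sinai) entropy of `T` with respect to `μ`: the supremum over
finite measurable partitions `P` of `lim (1/n) H(P ∨ T⁻¹P ∨ ⋯ ∨ T^{-(n-1)}P)`. -/
noncomputable def ksEntropy (μ : Measure α) (T : α → α) : ℝ≥0∞ :=
  ⨆ (k : ℕ) (f : α → Fin k) (_ : Measurable f),
    limsup (fun n : ℕ => ENNReal.ofReal (partitionEntropy μ (joinLabel T f n) / n)) atTop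

end Entropy

/-! ## Dimensions of measures -/

section Dimension

variable {Y : Type*} [MetricSpace Y] [MeasurableSpace Y] [BorelSpace Y]

/-- `μ` has pointwise dimension `d` at `x`: `log μ(B(x,r)) / log r → d` as `r → 0⁺`
(with `log 0 = -∞`). -/
def HasPointwiseDim (μ : Measure Y) (x : Y) (d : ℝ≥0∞) : Prop :=
  Tendsto (fun r : ℝ => ENNReal.log (μ (Metric.ball x r)) / ((Real.log r : ℝ) : EReal))
    (𝓝[>] 0) (𝓝 (d : EReal))

/-- `HD_⋆(μ) = inf {HD(A) : μ(A) > 0}`. -/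
noncomputable def lowerHausdorffDim (μ : Measure Y) : ℝ≥0∞ :=
  ⨅ (A : Set Y) (_ : MeasurableSet A) (_ : 0 < μ A), dimH A

/-- `HD^⋆(μ) = inf {HD(A) : μ(Y \ A) = 0}`. -/
noncomputable def upperHausdorffDim (μ : Measure Y) : ℝ≥0∞ :=
  ⨅ (A : Set Y) (_ : MeasurableSet A) (_ : μ Aᶜ = 0), dimH A

/-- The Hausdorff dimension of `μ` is defined and equals `d`. -/
def HasHausdorffDim (μ : Measure Y) (d : ℝ≥0∞) : Prop :=
  lowerHausdorffDim μ = d ∧ upperHausdorffDim μ = d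

end Dimension

/-- The Lyapunov exponent `-∫ log l dm(l) - ∑_{i ≥ 0} (ν_{2i+1} + ν_{2i+2}) log ρ_i` in `(-∞, ∞]`;
the terms of the series are nonnegative (`0 < ρ_i < 1`). -/
noncomputable def lyapunovExponent {ε : ℝ} (m : Measure (Icc (1 - ε) (1 + ε))) (p : PMF ℕ)
    (ρ : ℕ → ℝ) : EReal :=
  ((-∫ l, Real.log (l : ℝ) ∂m : ℝ) : EReal) +
    ((∑' i : ℕ, (p (2 * i) + p (2 * i + 1)) * ENNReal.ofReal (-Real.log (ρ i)) : ℝ≥0∞) : EReal)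

/-! The skew product F(l, ω) = (θ l, shift ω) is ergodic for m × ν (`ergodic_prodMap_seqShift`), and
π(l, ω) is the image of π(F(l, ω)) under an affine map whose ratio c depends only on l and the first
letter. Let r_n be the length of X times the product of the first n ratios, and M_n the mass that
the projected measure gives to the ball of radius r_n about π(l, ω). Birkhoff's theorem gives -log
r_n / n → χ, the Lyapunov exponent. Once -log M_n / n → h is known, the pointwise dimension is h/χ,
or 0 if χ = ∞.

Because images of cylinders may overlap, M_n is not a product of weights. However, the part of M_n
carried by the cylinder of the first letter equals p(ω_0) · M_{n-1}∘F, by affinity and independence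
(`map_restrict_closedBall`). With I_n ≥ 0 the logarithm of the ratio of the whole to that part,
iteration yields -log M_n = Σ_{k<n} -log p(ω_k) - Σ_{k<n} I_{n-k}∘F^k (`neg_log_codeMass`). The I_n
converge almost everywhere by differentiation of measures (`ae_exists_tendsto_overlapInfo`). Their
supremum is integrable, by a Besicovitch maximal inequality and the finite entropy of ν
(`lintegral_iSup_codeInfo_ne_top`). Maker's theorem then applies to the second sum, and h = H(ν) - ∫
lim I_n ≤ H(ν).

A pointwise dimension that is almost everywhere constant is the Hausdorff dimension of the measure
(`hasHausdorffDim_of_ae_hasPointwiseDim`). The bound obtained, H(ν)/χ, is at most the stated one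
since h(m) ≥ 0. -/

/-! ## The pointwise ergodic theorem -/

section PointwiseErgodic

variable {Ω : Type*} {T : Ω → Ω} {f : Ω → ℝ}

/-- The running maximum `max (0, S₁ f, …, Sₙ f)` of the Birkhoff sums of `f`. -/
noncomputable def birkhoffMax (T : Ω → Ω) (f : Ω → ℝ) : ℕ → Ω → ℝ
  | 0, _ => 0
  | n + 1, x => max 0 (f x + birkhoffMax T f n (T x))

theorem birkhoffMax_nonneg (n : ℕ) (x : Ω) : 0 ≤ birkhoffMax T f n x := by
  cases n with
  | zero => exact le_rfl
  | succ n => exact le_max_left _ _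

theorem birkhoffMax_le_succ (n : ℕ) : ∀ x, birkhoffMax T f n x ≤ birkhoffMax T f (n + 1) x := by
  induction n with
  | zero => exact fun x => birkhoffMax_nonneg 1 x
  | succ n ih => exact fun x => max_le_max le_rfl (by simpa using ih (T x))

theorem monotone_birkhoffMax (x : Ω) : Monotone fun n => birkhoffMax T f n x :=
  monotone_nat_of_le_succ fun n => birkhoffMax_le_succ n x

theorem birkhoffSum_le_birkhoffMax (n : ℕ) :
    ∀ x, birkhoffSum T f n x ≤ birkhoffMax T f n x := by
  induction n with
  | zero => intro x; simp [birkhoffMax]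
  | succ n ih =>
    intro x
    rw [birkhoffSum_succ']
    exact (by simpa using ih (T x) : f x + birkhoffSum T f n (T x) ≤ _).trans (le_max_right _ _)

theorem birkhoffAverage_real_eq (n : ℕ) (x : Ω) :
    birkhoffAverage ℝ T f n x = birkhoffSum T f n x / n := by
  rw [birkhoffAverage, smul_eq_mul, inv_mul_eq_div]

/-- Makes the set of points with bounded running maxima strictly invariant, so that ergodicity gives
it measure 0 or 1. -/
theorem bddAbove_birkhoffMax_comp_iff (x : Ω) :
    BddAbove (range fun n => birkhoffMax T f n (T x)) ↔
      BddAbove (range fun n => birkhoffMax T f n x) := by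
  constructor
  · rintro ⟨B, hB⟩
    refine ⟨max 0 (f x + B), ?_⟩
    rintro _ ⟨n, rfl⟩
    refine (birkhoffMax_le_succ n x).trans (max_le_max le_rfl ?_)
    have := hB ⟨n, rfl⟩
    simpa using this
  · rintro ⟨B, hB⟩
    refine ⟨B - f x, ?_⟩
    rintro _ ⟨n, rfl⟩
    have h1 : birkhoffMax T f (n + 1) x ≤ B := hB ⟨n + 1, rfl⟩
    have h2 : f x + birkhoffMax T f n (T x) ≤ birkhoffMax T f (n + 1) x := le_max_right _ _
    simp only
    linarith

variable [MeasurableSpace Ω] {μ : Measure Ω}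

theorem measurable_birkhoffMax (hT : Measurable T) (hf : Measurable f) (n : ℕ) :
    Measurable (birkhoffMax T f n) := by
  induction n with
  | zero => exact measurable_const
  | succ n ih => exact measurable_const.max (hf.add (ih.comp hT))

theorem integrable_birkhoffMax [IsFiniteMeasure μ] (hT : MeasurePreserving T μ μ)
    (hf : Integrable f μ) (n : ℕ) : Integrable (birkhoffMax T f n) μ := by
  induction n with
  | zero => exact integrable_const 0
  | succ n ih =>
    exact (integrable_const (0 : ℝ)).sup (hf.add (hT.integrable_comp_of_integrable ih))

/-- With M_n the running maximum, M_{n+1} - M_n∘T = max(-M_n∘T, f) has nonnegative integral, because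
M_n increases and T preserves μ. If M_n were unbounded almost everywhere, this would converge to f,
dominated by |f|, forcing ∫ f ≥ 0. -/
theorem Ergodic.ae_bddAbove_birkhoffMax [IsProbabilityMeasure μ] (hT : Ergodic T μ)
    (hfm : Measurable f) (hf : Integrable f μ) (h : ∫ x, f x ∂μ < 0) :
    ∀ᵐ x ∂μ, BddAbove (range fun n => birkhoffMax T f n x) := by
  have hTm := hT.toMeasurePreserving.measurable
  have hA : MeasurableSet {x | BddAbove (range fun n => birkhoffMax T f n x)} :=
    measurableSet_bddAbove_range fun n => measurable_birkhoffMax hTm hfm n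
  have hinv : T ⁻¹' {x | BddAbove (range fun n => birkhoffMax T f n x)} =
      {x | BddAbove (range fun n => birkhoffMax T f n x)} := by
    ext x
    exact bddAbove_birkhoffMax_comp_iff x
  rcases hT.toPreErgodic.ae_mem_or_ae_notMem hA hinv with h1 | h1
  · exact h1
  exfalso
  have hint : ∀ n, Integrable (fun x => birkhoffMax T f n (T x)) μ := fun n =>
    hT.toMeasurePreserving.integrable_comp_of_integrable
      (integrable_birkhoffMax hT.toMeasurePreserving hf n)
  have hD : ∀ n x, birkhoffMax T f (n + 1) x - birkhoffMax T f n (T x) =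
      max (-birkhoffMax T f n (T x)) (f x) := by
    intro n x
    rw [birkhoffMax, ← max_sub_sub_right]
    simp
  have hlim : Tendsto (fun n => ∫ x, (birkhoffMax T f (n + 1) x - birkhoffMax T f n (T x)) ∂μ)
      atTop (𝓝 (∫ x, f x ∂μ)) := by
    refine tendsto_integral_of_dominated_convergence (fun x => |f x|) (fun n => ?_) hf.abs
      (fun n => ?_) ?_
    · exact ((integrable_birkhoffMax hT.toMeasurePreserving hf (n + 1)).sub
        (hint n)).aestronglyMeasurable
    · refine Eventually.of_forall fun x => ?_
      rw [hD, Real.norm_eq_abs, abs_le]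
      refine ⟨(neg_abs_le _).trans (le_max_right _ _), max_le ?_ (le_abs_self _)⟩
      exact (neg_nonpos.2 (birkhoffMax_nonneg n (T x))).trans (abs_nonneg _)
    · filter_upwards [h1] with x hx
      have hx' : ¬ BddAbove (range fun n => birkhoffMax T f n (T x)) := fun h =>
        hx ((bddAbove_birkhoffMax_comp_iff x).1 h)
      have hat : Tendsto (fun n => birkhoffMax T f n (T x)) atTop atTop :=
        tendsto_atTop_atTop_of_monotone' (monotone_birkhoffMax (T x)) hx'
      refine tendsto_const_nhds.congr' ?_
      filter_upwards [hat.eventually_ge_atTop (-f x)] with n hn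
      rw [hD, max_eq_right (by linarith)]
  have hnn : ∀ n, 0 ≤ ∫ x, (birkhoffMax T f (n + 1) x - birkhoffMax T f n (T x)) ∂μ := by
    intro n
    have hcomp : ∫ x, birkhoffMax T f n (T x) ∂μ = ∫ x, birkhoffMax T f n x ∂μ := by
      have := integral_map (μ := μ) hTm.aemeasurable (f := birkhoffMax T f n)
        (measurable_birkhoffMax hTm hfm n).aestronglyMeasurable
      rw [← this, hT.toMeasurePreserving.map_eq]
    rw [integral_sub (integrable_birkhoffMax hT.toMeasurePreserving hf (n + 1)) (hint n), hcomp,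
      sub_nonneg]
    exact integral_mono (integrable_birkhoffMax hT.toMeasurePreserving hf n)
      (integrable_birkhoffMax hT.toMeasurePreserving hf (n + 1)) (birkhoffMax_le_succ n)
  exact absurd (ge_of_tendsto' hlim hnn) (not_le.2 h)

/-- For c' strictly between ∫ f and c, the function f - c' has negative integral, so its Birkhoff
sums are bounded by some B and the averages of f are at most c' + B/n. -/
theorem Ergodic.ae_eventually_birkhoffAverage_lt [IsProbabilityMeasure μ] (hT : Ergodic T μ)
    (hfm : Measurable f) (hf : Integrable f μ) {c : ℝ} (hc : ∫ x, f x ∂μ < c) :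
    ∀ᵐ x ∂μ, ∀ᶠ n in atTop, birkhoffAverage ℝ T f n x < c := by
  obtain ⟨c', hc', hcc'⟩ := exists_between hc
  have hneg : ∫ x, (f x - c') ∂μ < 0 := by
    rw [integral_sub hf (integrable_const c')]
    simpa using hc'
  filter_upwards [hT.ae_bddAbove_birkhoffMax (hfm.sub measurable_const)
    (hf.sub (integrable_const c')) hneg] with x ⟨B, hB⟩
  have hlim : Tendsto (fun n : ℕ => c' + B / n) atTop (𝓝 (c' + 0)) :=
    tendsto_const_nhds.add (tendsto_const_div_atTop_nhds_zero_nat B)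
  rw [add_zero] at hlim
  filter_upwards [hlim.eventually_lt_const hcc', eventually_gt_atTop 0] with n hn hn0
  refine lt_of_le_of_lt ?_ hn
  have hn0' : (0 : ℝ) < n := by exact_mod_cast hn0
  have h1 : birkhoffSum T (fun x => f x - c') n x ≤ B :=
    (birkhoffSum_le_birkhoffMax n x).trans (hB ⟨n, rfl⟩)
  have h2 : birkhoffSum T (fun x => f x - c') n x = birkhoffSum T f n x - n * c' := by
    simp [birkhoffSum]
  rw [birkhoffAverage_real_eq, div_le_iff₀ hn0', add_mul, div_mul_cancel₀ _ hn0'.ne']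
  linarith

/-- **Birkhoff's pointwise ergodic theorem** for ergodic transformations. -/
theorem Ergodic.ae_tendsto_birkhoffAverage [IsProbabilityMeasure μ] (hT : Ergodic T μ)
    (hfm : Measurable f) (hf : Integrable f μ) :
    ∀ᵐ x ∂μ, Tendsto (fun n => birkhoffAverage ℝ T f n x) atTop (𝓝 (∫ x, f x ∂μ)) := by
  have h1 : ∀ᵐ x ∂μ, ∀ q : ℚ, ∫ x, f x ∂μ < q → ∀ᶠ n in atTop, birkhoffAverage ℝ T f n x < q :=
    ae_all_iff.2 fun q => by
      by_cases hq : ∫ x, f x ∂μ < q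
      · filter_upwards [hT.ae_eventually_birkhoffAverage_lt hfm hf hq] with x hx _ using hx
      · exact Eventually.of_forall fun x h => absurd h hq
  have h2 : ∀ᵐ x ∂μ, ∀ q : ℚ, (q : ℝ) < ∫ x, f x ∂μ → ∀ᶠ n in atTop,
      q < birkhoffAverage ℝ T f n x :=
    ae_all_iff.2 fun q => by
      by_cases hq : (q : ℝ) < ∫ x, f x ∂μ
      · have hq' : ∫ x, (-f) x ∂μ < -(q : ℝ) := by
          simp only [Pi.neg_apply, integral_neg]
          linarith
        filter_upwards [hT.ae_eventually_birkhoffAverage_lt hfm.neg hf.neg hq'] with x hx _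
        filter_upwards [hx] with n hn
        rw [birkhoffAverage_neg] at hn
        simpa using hn
      · exact Eventually.of_forall fun x h => absurd h hq
  filter_upwards [h1, h2] with x hx1 hx2
  refine tendsto_order.2 ⟨fun a ha => ?_, fun a ha => ?_⟩
  · obtain ⟨q, hq1, hq2⟩ := exists_rat_btwn ha
    filter_upwards [hx2 q hq2] with n hn using hq1.trans hn
  · obtain ⟨q, hq1, hq2⟩ := exists_rat_btwn ha
    filter_upwards [hx1 q hq1] with n hn using hn.trans hq2

/-- The Birkhoff averages of a nonnegative function of infinite integral tend to infinity. -/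
theorem Ergodic.ae_tendsto_birkhoffAverage_atTop [IsProbabilityMeasure μ] (hT : Ergodic T μ)
    (hfm : Measurable f) (hf0 : ∀ x, 0 ≤ f x) (hf : ∫⁻ x, ENNReal.ofReal (f x) ∂μ = ∞) :
    ∀ᵐ x ∂μ, Tendsto (fun n => birkhoffAverage ℝ T f n x) atTop atTop := by
  -- Truncation at M: the averages of f dominate those of min(f, M), whose limits ∫ min(f, M) are
  -- unbounded in M by monotone convergence.
  have hmeas : ∀ M : ℕ, Measurable fun x => min (f x) M := fun M => hfm.min measurable_const
  have hint : ∀ M : ℕ, Integrable (fun x => min (f x) M) μ := fun M =>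
    Integrable.of_bound (hmeas M).aestronglyMeasurable M (Eventually.of_forall fun x => by
      rw [Real.norm_of_nonneg (le_min (hf0 x) M.cast_nonneg)]
      exact min_le_right _ _)
  have hB : ∀ᵐ x ∂μ, ∀ M : ℕ, Tendsto (fun n => birkhoffAverage ℝ T (fun x => min (f x) M) n x)
      atTop (𝓝 (∫ x, min (f x) M ∂μ)) :=
    ae_all_iff.2 fun M => hT.ae_tendsto_birkhoffAverage (hmeas M) (hint M)
  have hsup : ∀ K : ℝ, ∃ M : ℕ, K < ∫ x, min (f x) M ∂μ := by
    intro K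
    have hl : Tendsto (fun M : ℕ => ∫⁻ x, ENNReal.ofReal (min (f x) M) ∂μ) atTop (𝓝 ∞) := by
      rw [← hf]
      refine lintegral_tendsto_of_tendsto_of_monotone
        (fun M => (hmeas M).ennreal_ofReal.aemeasurable) ?_ ?_
      · refine Eventually.of_forall fun x M N hMN => ENNReal.ofReal_le_ofReal ?_
        exact min_le_min le_rfl (by exact_mod_cast hMN)
      · refine Eventually.of_forall fun x => tendsto_const_nhds.congr' ?_
        filter_upwards [eventually_ge_atTop ⌈f x⌉₊] with M hM
        rw [min_eq_left (Nat.ceil_le.1 hM)]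
    obtain ⟨M, hM⟩ := (hl.eventually_const_lt (ENNReal.ofReal_lt_top (r := K))).exists
    refine ⟨M, ?_⟩
    rw [← ofReal_integral_eq_lintegral_ofReal (hint M)
      (Eventually.of_forall fun x => le_min (hf0 x) M.cast_nonneg)] at hM
    exact (ENNReal.ofReal_lt_ofReal_iff'.1 hM).1
  filter_upwards [hB] with x hx
  refine tendsto_atTop.2 fun K => ?_
  obtain ⟨M, hM⟩ := hsup K
  filter_upwards [(hx M).eventually_const_lt hM] with n hn
  refine hn.le.trans ?_
  rw [birkhoffAverage_real_eq, birkhoffAverage_real_eq]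
  exact div_le_div_of_nonneg_right (Finset.sum_le_sum fun k _ => min_le_left _ _) n.cast_nonneg

/-- **Maker's theorem**: a generalized pointwise ergodic theorem for dominated sequences of functions
that converge almost everywhere. -/
theorem Ergodic.ae_tendsto_sum_div_of_dominated [IsProbabilityMeasure μ] (hT : Ergodic T μ)
    {G : ℕ → Ω → ℝ} {g V : Ω → ℝ} (hG : ∀ j, Measurable (G j)) (hg : Measurable g)
    (hVm : Measurable V) (hV : Integrable V μ) (hGV : ∀ᵐ x ∂μ, ∀ j, |G j x| ≤ V x)
    (hlim : ∀ᵐ x ∂μ, Tendsto (fun j => G j x) atTop (𝓝 (g x))) :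
    Integrable g μ ∧ ∀ᵐ x ∂μ, Tendsto
      (fun n : ℕ => (∑ k ∈ Finset.range n, G (n - k) (T^[k] x)) / n) atTop (𝓝 (∫ x, g x ∂μ)) := by
  have hgV : ∀ᵐ x ∂μ, |g x| ≤ V x := by
    filter_upwards [hGV, hlim] with x h1 h2 using le_of_tendsto' h2.abs h1
  have hgi : Integrable g μ := hV.mono' hg.aestronglyMeasurable hgV
  refine ⟨hgi, ?_⟩
  -- The tail supremum is bounded by 2V and tends to 0, so its integral tends to 0. It controls the
  -- error of every term of index at least N simultaneously.
  let H : ℕ → Ω → ℝ := fun N x => ⨆ j, |G (N + j) x - g x|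
  have hHm : ∀ N, Measurable (H N) := fun N =>
    Measurable.iSup fun j => ((hG (N + j)).sub hg).abs
  have hbd : ∀ᵐ x ∂μ, ∀ j, |G j x - g x| ≤ 2 * V x := by
    filter_upwards [hGV, hgV] with x h1 h2 j
    have := abs_sub (G j x) (g x)
    linarith [h1 j]
  have hHle : ∀ᵐ x ∂μ, ∀ N j, |G (N + j) x - g x| ≤ H N x := by
    filter_upwards [hbd] with x hx N j
    exact le_ciSup (f := fun j => |G (N + j) x - g x|) ⟨2 * V x, by rintro _ ⟨j, rfl⟩; exact hx _⟩ j
  have hHV : ∀ᵐ x ∂μ, ∀ N, |H N x| ≤ 2 * V x := by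
    filter_upwards [hbd] with x hx N
    rw [abs_of_nonneg (Real.iSup_nonneg fun j => abs_nonneg _)]
    exact ciSup_le fun j => hx _
  have hHlim : ∀ᵐ x ∂μ, Tendsto (fun N => H N x) atTop (𝓝 0) := by
    filter_upwards [hlim] with x hx
    rw [Metric.tendsto_atTop] at hx ⊢
    intro e he
    obtain ⟨N, hN⟩ := hx (e / 2) (half_pos he)
    refine ⟨N, fun n hn => ?_⟩
    rw [Real.dist_0_eq_abs, abs_of_nonneg (Real.iSup_nonneg fun j => abs_nonneg _)]
    refine (ciSup_le fun j => ?_).trans_lt (half_lt_self he)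
    exact (hN (n + j) (by omega)).le
  have hHi : ∀ N, Integrable (H N) μ := fun N =>
    (hV.const_mul 2).mono' (hHm N).aestronglyMeasurable (hHV.mono fun x hx => hx N)
  have hHint : Tendsto (fun N => ∫ x, H N x ∂μ) atTop (𝓝 0) := by
    have := tendsto_integral_of_dominated_convergence (fun x => 2 * V x)
      (fun N => (hHm N).aestronglyMeasurable) (hV.const_mul 2)
      (fun N => hHV.mono fun x hx => hx N) hHlim
    simpa using this
  have horb : ∀ᵐ x ∂μ, ∀ k, (∀ j, |G j (T^[k] x) - g (T^[k] x)| ≤ 2 * V (T^[k] x)) ∧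
      ∀ N j, |G (N + j) (T^[k] x) - g (T^[k] x)| ≤ H N (T^[k] x) :=
    ae_all_iff.2 fun k =>
      (hT.toMeasurePreserving.iterate k).quasiMeasurePreserving.ae (hbd.and hHle)
  have hBH : ∀ᵐ x ∂μ, ∀ N, Tendsto (fun n => birkhoffAverage ℝ T (H N) n x) atTop
      (𝓝 (∫ x, H N x ∂μ)) :=
    ae_all_iff.2 fun N => hT.ae_tendsto_birkhoffAverage (hHm N) (hHi N)
  filter_upwards [horb, hBH, hT.ae_tendsto_birkhoffAverage hg hgi,
    hT.ae_tendsto_birkhoffAverage (hVm.const_mul 2) (hV.const_mul 2)] with x hx hxH hxg hxV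
  simp only [birkhoffAverage_real_eq] at hxH hxg hxV
  -- The last N terms of a Birkhoff sum are o(n), since the averages converge.
  have hshift : ∀ N : ℕ, Tendsto (fun n : ℕ => (birkhoffSum T (fun x => 2 * V x) n x -
      birkhoffSum T (fun x => 2 * V x) (n - N) x) / n) atTop (𝓝 0) := by
    intro N
    have h1 := hxV.comp (tendsto_sub_atTop_nat N)
    have h2 : Tendsto (fun n : ℕ => 1 - (N : ℝ) / n) atTop (𝓝 (1 - 0)) :=
      tendsto_const_nhds.sub (tendsto_const_div_atTop_nhds_zero_nat (N : ℝ))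
    have h3 := hxV.sub (h1.mul h2)
    simp only [sub_zero, mul_one, sub_self] at h3
    refine h3.congr' ?_
    filter_upwards [eventually_gt_atTop N] with n hn
    have hn0 : (n : ℝ) ≠ 0 := by
      have : n ≠ 0 := by omega
      exact_mod_cast this
    have hn1 : (n : ℝ) - N ≠ 0 := by
      have : (N : ℝ) < n := by exact_mod_cast hn
      linarith
    simp only [Function.comp_apply]
    rw [Nat.cast_sub hn.le]
    field_simp
  have hdiff : Tendsto (fun n : ℕ => (∑ k ∈ Finset.range n, G (n - k) (T^[k] x)) / n -
      birkhoffSum T g n x / n) atTop (𝓝 0) := by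
    rw [Metric.tendsto_atTop']
    intro e he
    obtain ⟨N, hN⟩ := (hHint.eventually_lt_const (half_pos he)).exists
    obtain ⟨n₀, hn₀⟩ := eventually_atTop.1 (((hxH N).eventually_lt_const hN).and
      ((hshift N).eventually_lt_const (half_pos he)))
    refine ⟨max n₀ N, fun n hn => ?_⟩
    obtain ⟨h1, h2⟩ := hn₀ n ((le_max_left _ _).trans hn.le)
    have hNn : N < n := (le_max_right _ _).trans_lt hn
    have hn0 : (0 : ℝ) < n := by exact_mod_cast (by omega : 0 < n)
    rw [Real.dist_0_eq_abs, ← sub_div, abs_div, Nat.abs_cast]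
    -- For k < n - N the index n - k exceeds N and H N bounds the error; the remaining N terms are
    -- bounded by 2V.
    have key : |∑ k ∈ Finset.range n, G (n - k) (T^[k] x) - birkhoffSum T g n x| ≤
        birkhoffSum T (H N) n x + (birkhoffSum T (fun x => 2 * V x) n x -
          birkhoffSum T (fun x => 2 * V x) (n - N) x) := by
      have hV0 : ∀ k, 0 ≤ 2 * V (T^[k] x) := fun k => (abs_nonneg _).trans ((hx k).1 0)
      have hH0 : ∀ k, 0 ≤ H N (T^[k] x) := fun k => (abs_nonneg _).trans ((hx k).2 N 0)
      have hs : birkhoffSum T (fun x => 2 * V x) n x -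
          birkhoffSum T (fun x => 2 * V x) (n - N) x =
          ∑ k ∈ Finset.range n, if n - N ≤ k then 2 * V (T^[k] x) else 0 := by
        simp only [birkhoffSum]
        rw [← Finset.sum_filter, ← Finset.sum_range_add_sum_Ico _ (Nat.sub_le n N),
          add_sub_cancel_left]
        refine Finset.sum_congr ?_ fun _ _ => rfl
        ext k
        simp only [Finset.mem_Ico, Finset.mem_filter, Finset.mem_range]
        tauto
      rw [hs, birkhoffSum, birkhoffSum, ← Finset.sum_sub_distrib, ← Finset.sum_add_distrib]
      refine (Finset.abs_sum_le_sum_abs _ _).trans (Finset.sum_le_sum fun k hk => ?_)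
      have hk' := Finset.mem_range.1 hk
      split_ifs with hkN
      · linarith [(hx k).1 (n - k), hH0 k]
      · have := (hx k).2 N (n - k - N)
        rw [show N + (n - k - N) = n - k by omega] at this
        linarith
    calc _ ≤ (birkhoffSum T (H N) n x + (birkhoffSum T (fun x => 2 * V x) n x -
          birkhoffSum T (fun x => 2 * V x) (n - N) x)) / n :=
            div_le_div_of_nonneg_right key hn0.le
      _ < e := by rw [add_div]; linarith
  simpa using hdiff.add hxg

end PointwiseErgodic

/-! ## Hausdorff dimension of measures with constant pointwise dimension -/

section PointwiseDimension

/-- The mass of an open ball is lower semicontinuous in its centre: an open ball is an increasing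
union of smaller ones, each contained in the nearby balls of the full radius. -/
theorem isClosed_setOf_measure_ball_le {Y : Type*} [MetricSpace Y] [MeasurableSpace Y]
    (κ : Measure Y) (r : ℝ) (c : ℝ≥0∞) : IsClosed {x | κ (Metric.ball x r) ≤ c} := by
  have hU : ∀ x : Y, Metric.ball x r = ⋃ n : ℕ, Metric.ball x (r - 1 / (n + 1)) := by
    intro x
    ext y
    simp only [Metric.mem_ball, mem_iUnion]
    constructor
    · intro h
      obtain ⟨n, hn⟩ := exists_nat_one_div_lt (sub_pos.2 h)
      exact ⟨n, by linarith⟩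
    · rintro ⟨n, hn⟩
      exact hn.trans (sub_lt_self _ (by positivity))
  rw [← isOpen_compl_iff, Metric.isOpen_iff]
  intro x hx
  simp only [mem_compl_iff, mem_ofPred_eq, not_le] at hx
  have hmono : Monotone fun n : ℕ => Metric.ball x (r - 1 / ((n : ℝ) + 1)) := by
    intro i j hij
    refine Metric.ball_subset_ball (sub_le_sub_left ?_ _)
    exact one_div_le_one_div_of_le (by positivity) (by exact_mod_cast Nat.succ_le_succ hij)
  rw [hU, hmono.measure_iUnion, lt_iSup_iff] at hx
  obtain ⟨n, hn⟩ := hx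
  refine ⟨1 / ((n : ℝ) + 1), by positivity, fun y hy => ?_⟩
  simp only [mem_compl_iff, mem_ofPred_eq, not_le]
  refine hn.trans_le (measure_mono (Metric.ball_subset_ball' ?_))
  rw [dist_comm]
  linarith [Metric.mem_ball.1 hy]

/-- Dually, the mass of a closed ball is upper semicontinuous in its centre, by continuity from
above of the finite measure κ. -/
theorem isClosed_setOf_le_measure_closedBall {Y : Type*} [MetricSpace Y] [MeasurableSpace Y]
    [BorelSpace Y] (κ : Measure Y) [IsFiniteMeasure κ] (r : ℝ) (c : ℝ≥0∞) :
    IsClosed {x | c ≤ κ (Metric.closedBall x r)} := by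
  have hU : ∀ x : Y, Metric.closedBall x r = ⋂ n : ℕ, Metric.closedBall x (r + 1 / (n + 1)) := by
    intro x
    ext y
    simp only [Metric.mem_closedBall, mem_iInter]
    constructor
    · exact fun h n => h.trans (le_add_of_nonneg_right (by positivity))
    · intro h
      refine le_of_forall_pos_lt_add fun e he => ?_
      obtain ⟨n, hn⟩ := exists_nat_one_div_lt he
      linarith [h n]
  rw [← isOpen_compl_iff, Metric.isOpen_iff]
  intro x hx
  simp only [mem_compl_iff, mem_ofPred_eq, not_le] at hx
  have hanti : Antitone fun n : ℕ => Metric.closedBall x (r + 1 / ((n : ℝ) + 1)) := by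
    intro i j hij
    refine Metric.closedBall_subset_closedBall (add_le_add_right ?_ _)
    exact one_div_le_one_div_of_le (by positivity) (by exact_mod_cast Nat.succ_le_succ hij)
  rw [hU, hanti.measure_iInter (fun n => Metric.isClosed_closedBall.measurableSet.nullMeasurableSet)
    ⟨0, measure_ne_top _ _⟩, iInf_lt_iff] at hx
  obtain ⟨n, hn⟩ := hx
  refine ⟨1 / ((n : ℝ) + 1), by positivity, fun y hy => ?_⟩
  simp only [mem_compl_iff, mem_ofPred_eq, not_le]
  refine lt_of_le_of_lt (measure_mono (Metric.closedBall_subset_closedBall' ?_)) hn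
  linarith [Metric.mem_ball.1 hy]

/-- Mass distribution principle. -/
theorem le_dimH_of_measure_ball_le {Y : Type*} [MetricSpace Y] [MeasurableSpace Y] [BorelSpace Y]
    (κ : Measure Y) {t δ : ℝ} (ht : 0 ≤ t) (hδ : 0 < δ) {P : Set Y} (hPm : MeasurableSet P)
    (hP : ∀ x ∈ P, ∀ r, 0 < r → r < δ → κ (Metric.ball x r) ≤ ENNReal.ofReal r ^ t)
    {A : Set Y} (hA : κ (A ∩ P) ≠ 0) : ENNReal.ofReal t ≤ dimH A := by
  have hle : κ.restrict P ≤ μH[t] := by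
    refine Measure.le_hausdorffMeasure t _ (ENNReal.ofReal (δ / 2)) (by positivity) fun s hs => ?_
    rw [Measure.restrict_apply' hPm]
    rcases (s ∩ P).eq_empty_or_nonempty with h0 | ⟨x, hxs, hxP⟩
    · simp [h0]
    have hfin : Metric.ediam s ≠ ∞ := (hs.trans_lt ENNReal.ofReal_lt_top).ne
    -- An open ball about a point of s contains s only when its radius exceeds the diameter, so r is
    -- afterwards decreased to the diameter. The threshold δ/2 above leaves room for this.
    have hb : ∀ r : ℝ, (Metric.ediam s).toReal < r → r < δ →
        κ (s ∩ P) ≤ ENNReal.ofReal r ^ t := by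
      intro r hr hrδ
      refine (measure_mono ?_).trans (hP x hxP r (ENNReal.toReal_nonneg.trans_lt hr) hrδ)
      intro y hy
      rw [Metric.mem_ball, dist_edist]
      exact lt_of_le_of_lt
        (ENNReal.toReal_mono hfin (Metric.edist_le_ediam_of_mem hy.1 hxs)) hr
    have hlim : Tendsto (fun r : ℝ => ENNReal.ofReal r ^ t) (𝓝[>] (Metric.ediam s).toReal)
        (𝓝 (ENNReal.ofReal (Metric.ediam s).toReal ^ t)) := by
      refine Tendsto.mono_left ?_ nhdsWithin_le_nhds
      exact (ENNReal.continuous_rpow_const.comp ENNReal.continuous_ofReal).tendsto _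
    rw [ENNReal.ofReal_toReal hfin] at hlim
    have hlt : (Metric.ediam s).toReal < δ := by
      have := ENNReal.toReal_mono ENNReal.ofReal_ne_top hs
      rw [ENNReal.toReal_ofReal (by positivity)] at this
      linarith
    refine ge_of_tendsto hlim ?_
    filter_upwards [Ioo_mem_nhdsGT hlt] with r hr using hb r hr.1 hr.2
  have hne : μH[t] A ≠ 0 := by
    intro h
    have := hle A
    rw [h, Measure.restrict_apply' hPm] at this
    exact hA (le_antisymm this bot_le)
  have h2 := le_dimH_of_hausdorffMeasure_ne_zero (s := A) (d := t.toNNReal)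
    (by rwa [Real.coe_toNNReal t ht])
  exact h2

/-- Cover Q by the cells of a grid of mesh 1/(n+1). For a cell meeting Q, diam^t is at most the mass
of a ball lying in the cell and its two neighbours. Each cell is counted three times, so the
t-dimensional Hausdorff measure of Q is at most 3. -/
theorem dimH_le_of_le_measure_closedBall (κ : Measure ℝ) [IsProbabilityMeasure κ] {t δ : ℝ}
    (ht : 0 < t) (hδ : 0 < δ) {Q : Set ℝ}
    (hQ : ∀ x ∈ Q, ∀ r, 0 < r → r < δ → ENNReal.ofReal r ^ t ≤ κ (Metric.closedBall x r)) :
    dimH Q ≤ ENNReal.ofReal t := by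
  let cell : ℕ → ℤ → Set ℝ := fun n j => {y | ⌊y / (1 / ((n : ℝ) + 1))⌋ = j}
  have hfm : ∀ n : ℕ, Measurable fun y : ℝ => ⌊y / (1 / ((n : ℝ) + 1))⌋ := fun n =>
    Int.measurable_floor.comp (measurable_id.div_const _)
  have hcell : ∀ n : ℕ, ∑' j, κ (cell n j) = 1 := by
    intro n
    have := tsum_measure_preimage_singleton (μ := κ) (countable_univ (α := ℤ))
      (f := fun y : ℝ => ⌊y / (1 / ((n : ℝ) + 1))⌋)
      (fun j _ => hfm n (measurableSet_singleton j))
    rw [tsum_univ (fun j : ℤ => κ ((fun y : ℝ => ⌊y / (1 / ((n : ℝ) + 1))⌋) ⁻¹' {j}))] at this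
    simp only [preimage_univ, measure_univ] at this
    exact this
  have hsum : ∀ (n : ℕ) (i : ℤ), ∑' j, κ (cell n (j + i)) = 1 := fun n i =>
    ((Equiv.addRight i).tsum_eq (fun j => κ (cell n j))).trans (hcell n)
  have hdiam : ∀ (n : ℕ) (j : ℤ), Metric.ediam (Q ∩ cell n j) ≤
      ENNReal.ofReal (1 / ((n : ℝ) + 1)) := by
    intro n j
    refine Metric.ediam_le fun x hx y hy => ?_
    rw [edist_dist, Real.dist_eq]
    refine ENNReal.ofReal_le_ofReal ?_
    have hp : (0 : ℝ) < 1 / ((n : ℝ) + 1) := by positivity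
    have h3 := Int.abs_sub_lt_one_of_floor_eq_floor ((hx.2 : _ = j).trans (hy.2 : _ = j).symm)
    rw [← sub_div, abs_div, abs_of_pos hp, div_lt_one hp] at h3
    exact h3.le
  have hball : ∀ (n : ℕ) (j : ℤ), ∀ x ∈ cell n j, Metric.closedBall x (1 / ((n : ℝ) + 1)) ⊆
      cell n (j + -1) ∪ cell n (j + 0) ∪ cell n (j + 1) := by
    intro n j x hx y hy
    have hp : (0 : ℝ) < 1 / ((n : ℝ) + 1) := by positivity
    rw [Metric.mem_closedBall, Real.dist_eq, ← div_le_one hp] at hy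
    have hy' : |(y - x) / (1 / ((n : ℝ) + 1))| ≤ 1 := by rwa [abs_div, abs_of_pos hp]
    rw [sub_div, abs_le] at hy'
    have hx' : ⌊x / (1 / ((n : ℝ) + 1))⌋ = j := hx
    rw [Int.floor_eq_iff] at hx'
    have h1 : j - 1 ≤ ⌊y / (1 / ((n : ℝ) + 1))⌋ := Int.le_floor.2 (by push_cast; linarith)
    have h2 : ⌊y / (1 / ((n : ℝ) + 1))⌋ < j + 2 := Int.floor_lt.2 (by push_cast; linarith)
    simp only [cell, mem_union, mem_ofPred_eq]
    omega
  have hlim : Tendsto (fun n : ℕ => ENNReal.ofReal (1 / ((n : ℝ) + 1))) atTop (𝓝 0) := by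
    rw [← ENNReal.ofReal_zero]
    exact ENNReal.tendsto_ofReal tendsto_one_div_add_atTop_nhds_zero_nat
  have hH := Measure.hausdorffMeasure_le_liminf_tsum t Q _ hlim (fun n j => Q ∩ cell n j)
    (Eventually.of_forall hdiam)
    (Eventually.of_forall fun n x hx => mem_iUnion.2 ⟨_, hx, rfl⟩)
  have hbound : ∀ᶠ n : ℕ in atTop, ∑' j, Metric.ediam (Q ∩ cell n j) ^ t ≤ 3 := by
    filter_upwards [tendsto_one_div_add_atTop_nhds_zero_nat.eventually_lt_const hδ] with n hn
    have hterm : ∀ j, Metric.ediam (Q ∩ cell n j) ^ t ≤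
        κ (cell n (j + -1)) + κ (cell n (j + 0)) + κ (cell n (j + 1)) := by
      intro j
      rcases (Q ∩ cell n j).eq_empty_or_nonempty with h0 | ⟨x, hxQ, hxc⟩
      · rw [h0, Metric.ediam_empty, ENNReal.zero_rpow_of_pos ht]
        exact bot_le
      · calc _ ≤ ENNReal.ofReal (1 / ((n : ℝ) + 1)) ^ t :=
              ENNReal.rpow_le_rpow (hdiam n j) ht.le
          _ ≤ κ (Metric.closedBall x (1 / ((n : ℝ) + 1))) := hQ x hxQ _ (by positivity) hn
          _ ≤ _ := measure_mono (hball n j x hxc)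
          _ ≤ _ := (measure_union_le _ _).trans (add_le_add_left (measure_union_le _ _) _)
    refine (ENNReal.tsum_le_tsum hterm).trans ?_
    rw [ENNReal.tsum_add, ENNReal.tsum_add, hsum, hsum, hsum]
    norm_num
  have hfin : μH[t] Q ≤ 3 := hH.trans (by
    calc _ ≤ liminf (fun _ : ℕ => (3 : ℝ≥0∞)) atTop := liminf_le_liminf hbound
      _ = 3 := liminf_const _)
  refine dimH_le_of_hausdorffMeasure_ne_top (d := t.toNNReal) ?_
  rw [Real.coe_toNNReal t ht.le]
  exact (hfin.trans_lt (by norm_num)).ne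

theorem log_div_log_of_ne_zero {c : ℝ≥0∞} (h0 : c ≠ 0) (hc : c ≠ ∞) (r : ℝ) :
    ENNReal.log c / ((Real.log r : ℝ) : EReal) =
      ((Real.log c.toReal / Real.log r : ℝ) : EReal) := by
  rw [ENNReal.log_pos_real h0 hc, EReal.coe_div]

theorem le_rpow_of_lt_log_div_log {c : ℝ≥0∞} (hc : c ≠ ∞) {r t : ℝ} (hr0 : 0 < r) (hr1 : r < 1)
    (h : (t : EReal) < ENNReal.log c / ((Real.log r : ℝ) : EReal)) :
    c ≤ ENNReal.ofReal r ^ t := by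
  rcases eq_or_ne c 0 with rfl | h0
  · exact bot_le
  rw [log_div_log_of_ne_zero h0 hc, EReal.coe_lt_coe_iff, lt_div_iff_of_neg (Real.log_neg hr0 hr1)]
    at h
  rw [ENNReal.ofReal_rpow_of_pos hr0]
  refine ENNReal.le_ofReal_iff_toReal_le hc (by positivity) |>.2 ?_
  rw [Real.le_rpow_iff_log_le (ENNReal.toReal_pos h0 hc) hr0]
  exact h.le

theorem rpow_le_of_log_div_log_lt {c : ℝ≥0∞} (hc : c ≠ ∞) {r t : ℝ} (hr0 : 0 < r) (hr1 : r < 1)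
    (h : ENNReal.log c / ((Real.log r : ℝ) : EReal) < (t : EReal)) :
    ENNReal.ofReal r ^ t ≤ c := by
  rcases eq_or_ne c 0 with rfl | h0
  -- For zero mass the quotient is -∞ divided by a negative number, that is +∞, contradicting the
  -- bound by t.
  · rw [ENNReal.log_zero, EReal.bot_div_of_neg_ne_bot (by exact_mod_cast Real.log_neg hr0 hr1)
      (EReal.coe_ne_bot _)] at h
    exact absurd h not_top_lt
  rw [log_div_log_of_ne_zero h0 hc, EReal.coe_lt_coe_iff, div_lt_iff_of_neg (Real.log_neg hr0 hr1)]
    at h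
  rw [ENNReal.ofReal_rpow_of_pos hr0]
  refine ENNReal.ofReal_le_iff_le_toReal hc |>.2 ?_
  rw [Real.rpow_le_iff_le_log hr0 (ENNReal.toReal_pos h0 hc)]
  exact h.le

theorem exists_nat_forall_of_eventually_nhdsGT {P : ℝ → Prop} (h : ∀ᶠ r in 𝓝[>] (0 : ℝ), P r) :
    ∃ k : ℕ, ∀ r, 0 < r → r < 1 / ((k : ℝ) + 1) → P r := by
  obtain ⟨u, hu, hP⟩ := (mem_nhdsGT_iff_exists_Ioo_subset).1 h
  obtain ⟨k, hk⟩ := exists_nat_one_div_lt (show (0 : ℝ) < u from hu)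
  exact ⟨k, fun r h0 h1 => hP ⟨h0, h1.trans hk⟩⟩

/-- For t on either side of d, almost every point lies in a countable union of closed sets on which
the comparison of ball masses with r^t is uniform for r < 1/(k+1). For t > d the union carries the
measure and has dimension at most t. For t < d, any set of positive measure meets one of them in
positive measure, and the mass distribution principle applies. -/
theorem hasHausdorffDim_of_ae_hasPointwiseDim {Ω : Type*} [MeasurableSpace Ω] (ν : Measure Ω)
    [IsProbabilityMeasure ν] {f : Ω → ℝ} (hf : Measurable f) {d : ℝ} (hd : 0 ≤ d)
    (h : ∀ᵐ ω ∂ν, HasPointwiseDim (ν.map f) (f ω) (ENNReal.ofReal d)) :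
    HasHausdorffDim (ν.map f) (ENNReal.ofReal d) := by
  have hprob : IsProbabilityMeasure (ν.map f) := Measure.isProbabilityMeasure_map hf.aemeasurable
  have hcoe : ((ENNReal.ofReal d : ℝ≥0∞) : EReal) = (d : EReal) := by
    rw [EReal.coe_ennreal_ofReal, max_eq_left hd]
  have hsmall : ∀ᶠ r in 𝓝[>] (0 : ℝ), 0 < r ∧ r < 1 := Ioo_mem_nhdsGT one_pos
  have hupper : upperHausdorffDim (ν.map f) ≤ ENNReal.ofReal d := by
    have hn : ∀ n : ℕ, upperHausdorffDim (ν.map f) ≤ ENNReal.ofReal (d + 1 / ((n : ℝ) + 1)) := by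
      intro n
      have hdn : d < d + 1 / ((n : ℝ) + 1) := lt_add_of_pos_right _ (by positivity)
      set t := d + 1 / ((n : ℝ) + 1)
      let Q : ℕ → Set ℝ := fun k => {x | ∀ r, 0 < r → r < 1 / ((k : ℝ) + 1) →
        ENNReal.ofReal r ^ t ≤ ν.map f (Metric.closedBall x r)}
      have hQ : ∀ k, IsClosed (Q k) := fun k => by
        simp only [Q, ofPred_forall]
        exact isClosed_iInter fun r => isClosed_iInter fun _ => isClosed_iInter fun _ =>
          isClosed_setOf_le_measure_closedBall _ _ _
      have hmeas : MeasurableSet (⋃ k, Q k) := .iUnion fun k => (hQ k).measurableSet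
      refine (iInf₂_le (⋃ k, Q k) hmeas).trans ((iInf_le _ ?_).trans ?_)
      · rw [Measure.map_apply hf hmeas.compl]
        refine measure_mono_null ?_ (ae_iff.1 h)
        intro ω hω hdim
        refine hω (mem_iUnion.2 (exists_nat_forall_of_eventually_nhdsGT ?_))
        have hev := Tendsto.eventually_lt_const
          (by rw [hcoe]; exact_mod_cast hdn : ((ENNReal.ofReal d : ℝ≥0∞) : EReal) < (t : EReal)) hdim
        filter_upwards [hev, hsmall] with r hr hr1
        exact (rpow_le_of_log_div_log_lt (measure_ne_top _ _) hr1.1 hr1.2 hr).trans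
          (measure_mono Metric.ball_subset_closedBall)
      · rw [dimH_iUnion]
        exact iSup_le fun k => dimH_le_of_le_measure_closedBall (ν.map f) (hd.trans_lt hdn)
          (by positivity : (0 : ℝ) < 1 / ((k : ℝ) + 1)) fun x hx => hx
    have hlim : Tendsto (fun n : ℕ => ENNReal.ofReal (d + 1 / ((n : ℝ) + 1))) atTop
        (𝓝 (ENNReal.ofReal (d + 0))) :=
      ENNReal.tendsto_ofReal (tendsto_const_nhds.add tendsto_one_div_add_atTop_nhds_zero_nat)
    rw [add_zero] at hlim
    exact ge_of_tendsto' hlim hn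
  have hlower : ENNReal.ofReal d ≤ lowerHausdorffDim (ν.map f) := by
    refine le_iInf fun A => le_iInf fun hA => le_iInf fun hA0 => ?_
    refine le_of_forall_lt fun c hc => ?_
    obtain ⟨t, hct, htd⟩ := ENNReal.lt_iff_exists_real_btwn.1 hc |>.imp fun t h => h.2
    have ht0 : 0 ≤ t := by
      by_contra h0
      rw [ENNReal.ofReal_of_nonpos (not_le.1 h0).le] at hct
      exact absurd hct not_lt_bot
    have htd' : t < d := (ENNReal.ofReal_lt_ofReal_iff'.1 htd).1
    let P : ℕ → Set ℝ := fun k => {x | ∀ r, 0 < r → r < 1 / ((k : ℝ) + 1) →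
      ν.map f (Metric.ball x r) ≤ ENNReal.ofReal r ^ t}
    have hP : ∀ k, IsClosed (P k) := fun k => by
      simp only [P, ofPred_forall]
      exact isClosed_iInter fun r => isClosed_iInter fun _ => isClosed_iInter fun _ =>
        isClosed_setOf_measure_ball_le _ _ _
    have hmeas : MeasurableSet (⋃ k, P k) := .iUnion fun k => (hP k).measurableSet
    have hnull : ν.map f (⋃ k, P k)ᶜ = 0 := by
      rw [Measure.map_apply hf hmeas.compl]
      refine measure_mono_null ?_ (ae_iff.1 h)
      intro ω hω hdim
      refine hω (mem_iUnion.2 (exists_nat_forall_of_eventually_nhdsGT ?_))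
      have hev := Tendsto.eventually_const_lt
        (by rw [hcoe]; exact_mod_cast htd' : (t : EReal) < ((ENNReal.ofReal d : ℝ≥0∞) : EReal)) hdim
      filter_upwards [hev, hsmall] with r hr hr1
      exact le_rpow_of_lt_log_div_log (measure_ne_top _ _) hr1.1 hr1.2 hr
    obtain ⟨k, hk⟩ : ∃ k, ν.map f (A ∩ P k) ≠ 0 := by
      by_contra hcon
      push Not at hcon
      refine hA0.ne' (measure_mono_null (t := (⋃ k, A ∩ P k) ∪ (⋃ k, P k)ᶜ) ?_
        (measure_union_null (measure_iUnion_null hcon) hnull))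
      rw [← inter_iUnion]
      intro x hx
      by_cases hxP : x ∈ ⋃ k, P k
      · exact Or.inl ⟨hx, hxP⟩
      · exact Or.inr hxP
    exact hct.trans_le (le_dimH_of_measure_ball_le (ν.map f) ht0
      (by positivity : (0 : ℝ) < 1 / ((k : ℝ) + 1)) (hP k).measurableSet (fun x hx => hx) hk)
  have hle : lowerHausdorffDim (ν.map f) ≤ upperHausdorffDim (ν.map f) := by
    refine le_iInf fun A => le_iInf fun hA => le_iInf fun hA0 => ?_
    refine (iInf₂_le A hA).trans (iInf_le _ ?_)
    rw [(prob_compl_eq_zero_iff hA).1 hA0]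
    exact one_pos
  exact ⟨le_antisymm (hle.trans hupper) hlower, le_antisymm hupper (hlower.trans hle)⟩

/-- The pointwise dimension can be computed along a sequence of radii tending to zero. -/
theorem hasPointwiseDim_of_tendsto_seq (κ : Measure ℝ) [IsProbabilityMeasure κ] (x : ℝ) {r : ℕ → ℝ}
    (hr0 : ∀ n, 0 < r n) (hanti : Antitone r) (hr : Tendsto r atTop (𝓝 0))
    (hpos : ∀ n, κ (Metric.closedBall x (r n)) ≠ 0) {d : ℝ}
    (h1 : Tendsto (fun n => -Real.log (κ.real (Metric.closedBall x (r n))) / -Real.log (r (n + 1)))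
      atTop (𝓝 d))
    (h2 : Tendsto (fun n => -Real.log (κ.real (Metric.closedBall x (r (n + 1)))) / -Real.log (r n))
      atTop (𝓝 d)) :
    HasPointwiseDim κ x (ENNReal.ofReal d) := by
  -- Each small radius u is placed between consecutive r (n + 1) < u ≤ r n. Monotonicity of mass and
  -- logarithm then squeezes the quotient at u between the two mixed quotients.
  have hex : ∀ u : ℝ, ∃ n : ℕ, 0 < u → u ≤ r 0 → r (n + 1) < u ∧ u ≤ r n := by
    intro u
    by_cases hu : 0 < u ∧ u ≤ r 0
    · obtain ⟨N, hN⟩ := (hr.eventually_lt_const hu.1).exists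
      have hE : ∃ n, r (n + 1) < u := ⟨N, (hanti N.le_succ).trans_lt hN⟩
      classical
      refine ⟨Nat.find hE, fun _ _ => ⟨Nat.find_spec hE, ?_⟩⟩
      rcases hn : Nat.find hE with _ | n
      · exact hu.2
      · exact not_lt.1 (Nat.find_min hE (hn ▸ n.lt_succ_self))
    · exact ⟨0, fun h1 h2 => absurd ⟨h1, h2⟩ hu⟩
  choose n hn using hex
  have hev : ∀ N, ∀ᶠ u in 𝓝[>] (0 : ℝ), 0 < u ∧ u < r N := fun N => Ioo_mem_nhdsGT (hr0 N)
  have hnlim : Tendsto n (𝓝[>] 0) atTop := by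
    refine tendsto_atTop.2 fun N => ?_
    filter_upwards [hev N] with u hu
    by_contra hlt
    have h := (hn u hu.1 (hu.2.le.trans (hanti N.zero_le))).1
    exact absurd (hu.2.trans_le (hanti (by omega : n u + 1 ≤ N))) (not_lt.2 h.le)
  have hκpos : ∀ u, 0 < u → κ (Metric.ball x u) ≠ 0 := by
    intro u hu h0
    obtain ⟨N, hN⟩ := (hr.eventually_lt_const hu).exists
    exact hpos N (measure_mono_null (Metric.closedBall_subset_ball hN) h0)
  have hlog : ∀ {A B : Set ℝ}, A ⊆ B → κ A ≠ 0 → -Real.log (κ.real B) ≤ -Real.log (κ.real A) := by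
    intro A B hAB hA
    exact neg_le_neg (Real.log_le_log (ENNReal.toReal_pos hA (measure_ne_top _ _))
      (measureReal_mono hAB))
  have hlog0 : ∀ A : Set ℝ, 0 ≤ -Real.log (κ.real A) := fun A =>
    neg_nonneg.2 (Real.log_nonpos measureReal_nonneg measureReal_le_one)
  have hd : 0 ≤ d := by
    refine ge_of_tendsto h2 ?_
    filter_upwards [hr.eventually_lt_const one_pos] with k hk
    exact div_nonneg (hlog0 _) (neg_nonneg.2 (Real.log_nonpos (hr0 k).le hk.le))
  have hreal : Tendsto (fun u => Real.log (κ.real (Metric.ball x u)) / Real.log u) (𝓝[>] 0)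
      (𝓝 d) := by
    obtain ⟨N, hN⟩ := (hr.eventually_lt_const one_pos).exists
    have hfacts : ∀ᶠ u in 𝓝[>] (0 : ℝ), 0 < u ∧ r (n u + 1) < u ∧ u ≤ r (n u) ∧ r (n u) < 1 := by
      filter_upwards [hev N, hnlim.eventually_ge_atTop N] with u hu hnu
      obtain ⟨h3, h4⟩ := hn u hu.1 (hu.2.le.trans (hanti N.zero_le))
      exact ⟨hu.1, h3, h4, (hanti hnu).trans_lt hN⟩
    refine tendsto_of_tendsto_of_tendsto_of_le_of_le' (h1.comp hnlim) (h2.comp hnlim) ?_ ?_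
    · filter_upwards [hfacts] with u ⟨hu, h3, h4, h5⟩
      rw [← neg_div_neg_eq (Real.log _)]
      refine div_le_div₀ (hlog0 _) (hlog (Metric.ball_subset_closedBall.trans
        (Metric.closedBall_subset_closedBall h4)) (hκpos u hu)) ?_ ?_
      · exact neg_pos.2 (Real.log_neg hu (h4.trans_lt h5))
      · exact neg_le_neg (Real.log_le_log (hr0 _) h3.le)
    · filter_upwards [hfacts] with u ⟨hu, h3, h4, h5⟩
      rw [← neg_div_neg_eq (Real.log _)]
      refine div_le_div₀ (hlog0 _) (hlog (Metric.closedBall_subset_ball h3) (hpos _)) ?_ ?_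
      · exact neg_pos.2 (Real.log_neg (hr0 _) h5)
      · exact neg_le_neg (Real.log_le_log hu h4)
  have hcoe : ((ENNReal.ofReal d : ℝ≥0∞) : EReal) = (d : EReal) := by
    rw [EReal.coe_ennreal_ofReal, max_eq_left hd]
  rw [HasPointwiseDim, hcoe]
  refine ((continuous_coe_real_ereal.tendsto d).comp hreal).congr' ?_
  filter_upwards [self_mem_nhdsWithin] with u hu
  exact (log_div_log_of_ne_zero (hκpos u hu) (measure_ne_top _ _) u).symm

theorem tendsto_succ_div_of_tendsto_div {u : ℕ → ℝ} {c : ℝ}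
    (hu : Tendsto (fun n : ℕ => u n / n) atTop (𝓝 c)) :
    Tendsto (fun n : ℕ => u (n + 1) / n) atTop (𝓝 c) := by
  have hq : Tendsto (fun n : ℕ => ((n + 1 : ℕ) : ℝ) / n) atTop (𝓝 1) := by
    have : Tendsto (fun n : ℕ => (1 : ℝ) + 1 / n) atTop (𝓝 (1 + 0)) :=
      tendsto_const_nhds.add (tendsto_const_div_atTop_nhds_zero_nat 1)
    rw [add_zero] at this
    refine this.congr' ?_
    filter_upwards [eventually_ne_atTop 0] with n hn
    field_simp
    push_cast
    ring
  have := (hu.comp (tendsto_add_atTop_nat 1)).mul hq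
  rw [mul_one] at this
  refine this.congr' ?_
  filter_upwards [eventually_ne_atTop 0] with n hn
  have : ((n + 1 : ℕ) : ℝ) ≠ 0 := by positivity
  simp only [Function.comp_apply]
  field_simp

theorem hasPointwiseDim_of_tendsto_div (κ : Measure ℝ) [IsProbabilityMeasure κ] (x : ℝ) {r : ℕ → ℝ}
    (hr0 : ∀ n, 0 < r n) (hanti : Antitone r) (hr : Tendsto r atTop (𝓝 0))
    (hpos : ∀ n, κ (Metric.closedBall x (r n)) ≠ 0) {h χ : ℝ} (hχ : 0 < χ)
    (h1 : Tendsto (fun n : ℕ => -Real.log (κ.real (Metric.closedBall x (r n))) / n) atTop (𝓝 h))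
    (h2 : Tendsto (fun n : ℕ => -Real.log (r n) / n) atTop (𝓝 χ)) :
    HasPointwiseDim κ x (ENNReal.ofReal (h / χ)) := by
  refine hasPointwiseDim_of_tendsto_seq κ x hr0 hanti hr hpos ?_ ?_
  · refine (h1.div (tendsto_succ_div_of_tendsto_div (u := fun n => -Real.log (r n)) h2) hχ.ne').congr' ?_
    filter_upwards [eventually_ne_atTop 0] with n hn
    exact div_div_div_cancel_right₀ (by exact_mod_cast hn) _ _
  · refine ((tendsto_succ_div_of_tendsto_div (u := fun n => -Real.log (κ.real (Metric.closedBall x (r n)))) h1).div h2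
      hχ.ne').congr' ?_
    filter_upwards [eventually_ne_atTop 0] with n hn
    exact div_div_div_cancel_right₀ (by exact_mod_cast hn) _ _

/-- Consecutive -log r_n need not be comparable here. Both mixed quotients are nevertheless
dominated by -log κ(B(x, r_{n+1})) / -log r_n, whose numerator is O(n) and whose denominator is
superlinear. -/
theorem hasPointwiseDim_zero_of_tendsto_div (κ : Measure ℝ) [IsProbabilityMeasure κ] (x : ℝ)
    {r : ℕ → ℝ} (hr0 : ∀ n, 0 < r n) (hanti : Antitone r) (hr : Tendsto r atTop (𝓝 0))
    (hpos : ∀ n, κ (Metric.closedBall x (r n)) ≠ 0) {h : ℝ}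
    (h1 : Tendsto (fun n : ℕ => -Real.log (κ.real (Metric.closedBall x (r n))) / n) atTop (𝓝 h))
    (h2 : Tendsto (fun n : ℕ => -Real.log (r n) / n) atTop atTop) :
    HasPointwiseDim κ x 0 := by
  have hmono : ∀ n, -Real.log (κ.real (Metric.closedBall x (r n))) ≤
      -Real.log (κ.real (Metric.closedBall x (r (n + 1)))) := fun n =>
    neg_le_neg (Real.log_le_log (ENNReal.toReal_pos (hpos _) (measure_ne_top _ _))
      (measureReal_mono (Metric.closedBall_subset_closedBall (hanti n.le_succ))))
  have h0 : Tendsto (fun n => -Real.log (κ.real (Metric.closedBall x (r (n + 1)))) /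
      -Real.log (r n)) atTop (𝓝 0) := by
    have := (tendsto_succ_div_of_tendsto_div
      (u := fun n => -Real.log (κ.real (Metric.closedBall x (r n)))) h1).mul h2.inv_tendsto_atTop
    rw [mul_zero] at this
    refine this.congr' ?_
    filter_upwards [eventually_ne_atTop 0] with n hn
    rw [Pi.inv_apply, ← div_eq_mul_inv]
    exact div_div_div_cancel_right₀ (by exact_mod_cast hn) _ _
  rw [← ENNReal.ofReal_zero]
  refine hasPointwiseDim_of_tendsto_seq κ x hr0 hanti hr hpos ?_ h0
  have hnn : ∀ n, 0 ≤ -Real.log (κ.real (Metric.closedBall x (r n))) := fun n =>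
    neg_nonneg.2 (Real.log_nonpos measureReal_nonneg measureReal_le_one)
  refine tendsto_of_tendsto_of_tendsto_of_le_of_le' tendsto_const_nhds h0 ?_ ?_
  all_goals
    filter_upwards [hr.eventually_lt_const one_pos] with n hn
    have hp : 0 < -Real.log (r n) := neg_pos.2 (Real.log_neg (hr0 n) hn)
    have hle : -Real.log (r n) ≤ -Real.log (r (n + 1)) :=
      neg_le_neg (Real.log_le_log (hr0 _) (hanti n.le_succ))
  · exact div_nonneg (hnn n) (hp.le.trans hle)
  · exact div_le_div₀ (hnn _) (hmono n) hp hle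

end PointwiseDimension

/-! ## The relative information of a partition given a map to the line -/

section OverlapInformation

/-- A weak type maximal inequality for ratios of measures of balls. -/
theorem exists_measure_le_of_closedBall_ratio_le : ∃ N : ℕ, ∀ (κ κ' : Measure ℝ) (R : ℝ) (t : ℝ≥0∞)
    (S : Set ℝ), (∀ x ∈ S, ∃ r, 0 < r ∧ r ≤ R ∧
      κ' (Metric.closedBall x r) ≤ t * κ (Metric.closedBall x r)) → κ' S ≤ N * t * κ univ := by
  -- The Besicovitch theorem covers S by N families of disjoint balls, N depending only on the line.
  -- Within a disjoint family the ratio bounds add up to at most t κ(ℝ).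
  obtain ⟨N, τ, hτ, hN⟩ := HasBesicovitchCovering.no_satelliteConfig (α := ℝ)
  refine ⟨N, fun κ κ' R t S hS => ?_⟩
  choose! r hr0 hrR hr using hS
  let q : Besicovitch.BallPackage S ℝ :=
    { c := fun x => x, r := fun x => r x, rpos := fun x => hr0 x x.2, r_bound := R,
      r_le := fun x => hrR x x.2 }
  obtain ⟨s, hs, hcov⟩ := Besicovitch.exist_disjoint_covering_families hτ hN q
  have hcount : ∀ i, (s i).Countable := fun i =>
    (hs i).countable_of_nonempty_interior fun x _ =>
      ⟨q.c x, by
        rw [interior_closedBall _ (q.rpos x).ne']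
        exact Metric.mem_ball_self (q.rpos x)⟩
  have hfam : ∀ i, κ' (⋃ j ∈ s i, Metric.closedBall (q.c j) (q.r j)) ≤ t * κ univ := by
    intro i
    refine (measure_biUnion_le κ' (hcount i) _).trans ?_
    calc ∑' j : s i, κ' (Metric.closedBall (q.c j) (q.r j))
        ≤ ∑' j : s i, t * κ (Metric.closedBall (q.c j) (q.r j)) :=
          ENNReal.tsum_le_tsum fun j => hr _ j.1.2
      _ = t * κ (⋃ j ∈ s i, Metric.closedBall (q.c j) (q.r j)) := by
          rw [ENNReal.tsum_mul_left, measure_biUnion (hcount i) (hs i)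
            fun _ _ => Metric.isClosed_closedBall.measurableSet]
      _ ≤ t * κ univ := by gcongr; exact subset_univ _
  have hsub : S ⊆ ⋃ i, ⋃ j ∈ s i, Metric.closedBall (q.c j) (q.r j) := by
    intro x hx
    have := hcov ⟨⟨x, hx⟩, rfl⟩
    simp only [mem_iUnion] at this ⊢
    obtain ⟨i, j, hj, h⟩ := this
    exact ⟨i, j, hj, Metric.ball_subset_closedBall h⟩
  calc κ' S ≤ κ' (⋃ i, ⋃ j ∈ s i, Metric.closedBall (q.c j) (q.r j)) := measure_mono hsub
    _ ≤ ∑ i, κ' (⋃ j ∈ s i, Metric.closedBall (q.c j) (q.r j)) := measure_iUnion_fintype_le _ _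
    _ ≤ ∑ _i : Fin N, t * κ univ := Finset.sum_le_sum fun i _ => hfam i
    _ = N * t * κ univ := by simp [mul_assoc]

variable {Ω : Type*} [MeasurableSpace Ω]

/-- The logarithm of the ratio of the mass of a ball to the part of that mass carried by the atom
`{e = e ω}` of the partition labelled by `e`. -/
noncomputable def overlapInfo (ν : Measure Ω) (f : Ω → ℝ) (e : Ω → ℕ) (ω : Ω) (r : ℝ) : ℝ :=
  Real.log ((ν.map f).real (Metric.closedBall (f ω) r) /
    ((ν.restrict (e ⁻¹' {e ω})).map f).real (Metric.closedBall (f ω) r))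

variable {ν : Measure Ω} {f : Ω → ℝ} {e : Ω → ℕ}

theorem map_restrict_le_map (hf : Measurable f) (s : Set Ω) :
    (ν.restrict s).map f ≤ ν.map f :=
  Measure.map_mono Measure.restrict_le_self hf

theorem overlapInfo_nonneg [IsProbabilityMeasure ν] (hf : Measurable f) (ω : Ω) (r : ℝ) : 0 ≤ overlapInfo ν f e ω r := by
  have hprob : IsProbabilityMeasure (ν.map f) := Measure.isProbabilityMeasure_map hf.aemeasurable
  rw [overlapInfo]
  rcases (measureReal_nonneg (μ := (ν.restrict (e ⁻¹' {e ω})).map f)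
    (s := Metric.closedBall (f ω) r)).eq_or_lt with h | h
  · rw [← h, div_zero, Real.log_zero]
  · refine Real.log_nonneg ((one_le_div h).2 ?_)
    exact ENNReal.toReal_mono (measure_ne_top _ _) (map_restrict_le_map hf _ _)

/-- The maximal inequality with t = exp(-u), applied to the projected measure and its part from the
atom. N serves all spaces, maps and atoms, which later gives a bound uniform over the fibres. -/
theorem exists_measure_overlapInfo_gt_le : ∃ N : ℕ, ∀ {Ω : Type*} [MeasurableSpace Ω]
    (ν : Measure Ω) [IsProbabilityMeasure ν] {f : Ω → ℝ} (_ : Measurable f) {e : Ω → ℕ}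
    (_ : Measurable e) (R u : ℝ) (_ : 0 ≤ u) (a : ℕ),
    ν (e ⁻¹' {a} ∩ {ω | ∃ r, 0 < r ∧ r ≤ R ∧ u < overlapInfo ν f e ω r}) ≤
      N * ENNReal.ofReal (Real.exp (-u)) := by
  obtain ⟨N, hN⟩ := exists_measure_le_of_closedBall_ratio_le
  refine ⟨N, fun {Ω} _ ν _ f hf e he R u hu a => ?_⟩
  have hprob : IsProbabilityMeasure (ν.map f) := Measure.isProbabilityMeasure_map hf.aemeasurable
  set S : Set ℝ := {x | ∃ r, 0 < r ∧ r ≤ R ∧ (ν.restrict (e ⁻¹' {a})).map f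
    (Metric.closedBall x r) ≤ ENNReal.ofReal (Real.exp (-u)) * ν.map f (Metric.closedBall x r)}
    with hS
  have hsub : e ⁻¹' {a} ∩ {ω | ∃ r, 0 < r ∧ r ≤ R ∧ u < overlapInfo ν f e ω r} ⊆
      f ⁻¹' S ∩ e ⁻¹' {a} := by
    rintro ω ⟨ha, r, hr0, hrR, hr⟩
    refine ⟨⟨r, hr0, hrR, ?_⟩, ha⟩
    have ha' : e ω = a := ha
    rw [overlapInfo, ha'] at hr
    -- A vanishing denominator would give `overlapInfo` the default value log 0 = 0, which is
    -- excluded by 0 ≤ u.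
    have hD : 0 < ((ν.restrict (e ⁻¹' {a})).map f).real (Metric.closedBall (f ω) r) := by
      refine measureReal_nonneg.lt_of_ne fun h => ?_
      rw [← h, div_zero, Real.log_zero] at hr
      exact absurd hr (not_lt.2 hu)
    have hq : 0 < (ν.map f).real (Metric.closedBall (f ω) r) :=
      hD.trans_le (ENNReal.toReal_mono (measure_ne_top _ _) (map_restrict_le_map hf _ _))
    rw [Real.lt_log_iff_exp_lt (div_pos hq hD), lt_div_iff₀ hD] at hr
    rw [← ENNReal.toReal_le_toReal (measure_ne_top _ _)
      (ENNReal.mul_ne_top ENNReal.ofReal_ne_top (measure_ne_top _ _)), ENNReal.toReal_mul,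
      ENNReal.toReal_ofReal (Real.exp_pos _).le, Real.exp_neg, inv_mul_eq_div,
      le_div_iff₀ (Real.exp_pos u), mul_comm]
    exact hr.le
  calc _ ≤ ν (f ⁻¹' S ∩ e ⁻¹' {a}) := measure_mono hsub
    _ = ν.restrict (e ⁻¹' {a}) (f ⁻¹' S) :=
        (Measure.restrict_apply' (he (measurableSet_singleton a))).symm
    _ ≤ (ν.restrict (e ⁻¹' {a})).map f S := Measure.le_map_apply hf.aemeasurable S
    _ ≤ N * ENNReal.ofReal (Real.exp (-u)) * ν.map f univ := hN _ _ R _ _ fun x hx => hx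
    _ = _ := by rw [measure_univ, mul_one]

/-- A discrete layer-cake bound: the excess of x over u is at most the number of k with u + k < x.
-/
theorem ENNReal.le_add_tsum_indicator (x u : ℝ≥0∞) :
    x ≤ u + ∑' k : ℕ, (Ioi (u + k)).indicator (1 : ℝ≥0∞ → ℝ≥0∞) x := by
  rcases eq_or_ne x ∞ with rfl | hx
  · rcases eq_or_ne u ∞ with rfl | hu
    · simp
    have : ∀ k : ℕ, (Ioi (u + k)).indicator (1 : ℝ≥0∞ → ℝ≥0∞) ∞ = 1 := fun k =>
      indicator_of_mem (by simp [hu.lt_top]) _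
    simp [this]
  · obtain ⟨n, hn⟩ := ENNReal.exists_nat_gt (ENNReal.sub_ne_top (b := u) hx)
    rw [← tsub_le_iff_left]
    have hfind : ∃ n : ℕ, x - u ≤ n := ⟨n, hn.le⟩
    classical
    calc x - u ≤ (Nat.find hfind : ℕ) := Nat.find_spec hfind
      _ = ∑ k ∈ Finset.range (Nat.find hfind), (1 : ℝ≥0∞) := by simp
      _ = ∑ k ∈ Finset.range (Nat.find hfind), (Ioi (u + k)).indicator (1 : ℝ≥0∞ → ℝ≥0∞) x := by
          refine Finset.sum_congr rfl fun k hk => ?_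
          have := Nat.find_min hfind (Finset.mem_range.1 hk)
          rw [not_le, lt_tsub_iff_left] at this
          exact (indicator_of_mem (show x ∈ Ioi (u + k) from this) (1 : ℝ≥0∞ → ℝ≥0∞)).symm
      _ ≤ _ := ENNReal.sum_le_tsum _

/-- A function with exponential tails on the atoms of a partition of finite entropy is integrable. -/
theorem lintegral_le_of_exponential_tails [IsProbabilityMeasure ν] (he : Measurable e) {V : Ω → ℝ≥0∞}
    (hV : Measurable V) {C : ℝ≥0∞} (h : ∀ (a : ℕ) (u : ℝ), 0 ≤ u →
      ν (e ⁻¹' {a} ∩ {ω | ENNReal.ofReal u < V ω}) ≤ C * ENNReal.ofReal (Real.exp (-u))) :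
    ∫⁻ ω, V ω ∂ν ≤ ∑' a, (ENNReal.ofReal (Real.negMulLog (ν.real (e ⁻¹' {a}))) +
      C * ν (e ⁻¹' {a}) * ∑' k : ℕ, ENNReal.ofReal (Real.exp (-k))) := by
  have hae : ∀ a, MeasurableSet (e ⁻¹' {a}) := fun a => he (measurableSet_singleton a)
  have hU : ⋃ a, e ⁻¹' {a} = univ := by
    ext ω
    simp
  rw [← setLIntegral_univ, ← hU, lintegral_iUnion hae fun a b hab =>
    Disjoint.preimage e (disjoint_singleton.2 hab)]
  refine ENNReal.tsum_le_tsum fun a => ?_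
  rcases eq_or_ne (ν (e ⁻¹' {a})) 0 with h0 | h0
  · rw [setLIntegral_measure_zero _ _ h0]
    exact bot_le
  have hp : 0 < ν.real (e ⁻¹' {a}) := ENNReal.toReal_pos h0 (measure_ne_top _ _)
  -- The tail bound carries no factor ν(atom), so the integral is cut at the level where exp(-u) =
  -- ν(atom). Below it the contribution is -ν(atom) log ν(atom); above it the tails become C ν(atom)
  -- exp(-k).
  set u := -Real.log (ν.real (e ⁻¹' {a})) with hu
  have hu0 : 0 ≤ u := neg_nonneg.2 (Real.log_nonpos hp.le measureReal_le_one)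
  have hsets : ∀ k : ℕ, MeasurableSet (V ⁻¹' Ioi (ENNReal.ofReal u + k)) := fun k =>
    hV measurableSet_Ioi
  calc ∫⁻ ω in e ⁻¹' {a}, V ω ∂ν
      ≤ ∫⁻ ω in e ⁻¹' {a}, (ENNReal.ofReal u +
          ∑' k : ℕ, (V ⁻¹' Ioi (ENNReal.ofReal u + k)).indicator 1 ω) ∂ν :=
        lintegral_mono fun ω => ENNReal.le_add_tsum_indicator (V ω) _
    _ = ENNReal.ofReal u * ν (e ⁻¹' {a}) +
          ∑' k : ℕ, ν (V ⁻¹' Ioi (ENNReal.ofReal u + k) ∩ e ⁻¹' {a}) := by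
        rw [lintegral_add_left measurable_const, setLIntegral_const, lintegral_tsum fun k =>
          (measurable_one.indicator (hsets k)).aemeasurable]
        congr 1
        refine tsum_congr fun k => ?_
        rw [lintegral_indicator_one (hsets k), Measure.restrict_apply (hsets k)]
    _ ≤ ENNReal.ofReal u * ν (e ⁻¹' {a}) +
          ∑' k : ℕ, C * ν (e ⁻¹' {a}) * ENNReal.ofReal (Real.exp (-k)) := by
        gcongr with k
        have hk := h a (u + k) (by positivity)
        rw [inter_comm]
        rw [ENNReal.ofReal_add hu0 k.cast_nonneg, ENNReal.ofReal_natCast, neg_add, Real.exp_add,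
          ENNReal.ofReal_mul (Real.exp_pos _).le, hu, neg_neg, Real.exp_log hp, measureReal_def,
          ENNReal.ofReal_toReal (measure_ne_top _ _), ← mul_assoc] at hk
        exact hk
    _ = _ := by
        rw [ENNReal.tsum_mul_left]
        congr 1
        rw [Real.negMulLog, neg_mul_comm, ENNReal.ofReal_mul hp.le, measureReal_def,
          ENNReal.ofReal_toReal (measure_ne_top _ _), mul_comm]
        rfl

/-- By Besicovitch differentiation the inverse ratio tends to the density of the atom's projected
measure with respect to the whole, that is, the conditional probability of the atom given f. This
density is positive almost everywhere on the atom, so the logarithm converges to a finite limit. -/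
theorem ae_exists_tendsto_overlapInfo [IsProbabilityMeasure ν] (hf : Measurable f) (he : Measurable e) :
    ∀ᵐ ω ∂ν, ∃ l, Tendsto (fun r => overlapInfo ν f e ω r) (𝓝[>] 0) (𝓝 l) := by
  have hprob : IsProbabilityMeasure (ν.map f) := Measure.isProbabilityMeasure_map hf.aemeasurable
  have key : ∀ᵐ ω ∂ν, ∀ a, ω ∈ e ⁻¹' {a} →
      ∃ l, Tendsto (fun r => overlapInfo ν f e ω r) (𝓝[>] 0) (𝓝 l) := by
    refine ae_all_iff.2 fun a => ?_
    rw [← ae_restrict_iff' (he (measurableSet_singleton a))]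
    have hac : (ν.restrict (e ⁻¹' {a})).map f ≪ ν.map f :=
      (map_restrict_le_map hf _).absolutelyContinuous
    have h1 := hac.ae_le (Besicovitch.ae_tendsto_rnDeriv ((ν.restrict (e ⁻¹' {a})).map f) (ν.map f))
    have h2 := hac.ae_le (Measure.rnDeriv_lt_top ((ν.restrict (e ⁻¹' {a})).map f) (ν.map f))
    filter_upwards [ae_of_ae_map hf.aemeasurable h1, ae_of_ae_map hf.aemeasurable h2,
      ae_of_ae_map hf.aemeasurable (Measure.rnDeriv_pos hac),
      ae_restrict_mem (he (measurableSet_singleton a))] with ω hω1 hω2 hω3 hω4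
    have hω4' : e ω = a := hω4
    set g := ((ν.restrict (e ⁻¹' {a})).map f).rnDeriv (ν.map f) (f ω)
    have hg : 0 < g.toReal := ENNReal.toReal_pos hω3.ne' hω2.ne
    refine ⟨Real.log (g.toReal)⁻¹, ?_⟩
    have hreal := (ENNReal.tendsto_toReal hω2.ne).comp hω1
    refine ((Real.continuousAt_log (inv_pos.2 hg).ne').tendsto.comp (hreal.inv₀ hg.ne')).congr ?_
    intro r
    simp only [Function.comp_apply, overlapInfo, hω4', ENNReal.toReal_div, inv_div, measureReal_def]
  filter_upwards [key] with ω hω using hω (e ω) rfl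

end OverlapInformation

/-! ## Bernoulli shifts and skew products -/

section BernoulliShift

instance (p : PMF ℕ) : IsProbabilityMeasure (bernoulliMeasure p) :=
  inferInstanceAs (IsProbabilityMeasure (Measure.infinitePi fun _ : ℕ => p.toMeasure))

/-- The shift on sequences. -/
def seqShift (ω : ℕ → ℕ) : ℕ → ℕ := fun k => ω (k + 1)

theorem measurable_seqShift : Measurable seqShift :=
  measurable_pi_lambda _ fun k => measurable_pi_apply (k + 1)

theorem seqShift_iterate_apply (n : ℕ) : ∀ (ω : ℕ → ℕ) (k : ℕ), seqShift^[n] ω k = ω (k + n) := by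
  induction n with
  | zero => intro ω k; rfl
  | succ n ih =>
    intro ω k
    rw [Function.iterate_succ_apply, ih, seqShift, add_assoc]

theorem measurePreserving_seqShift (p : PMF ℕ) :
    MeasurePreserving seqShift (bernoulliMeasure p) (bernoulliMeasure p) := by
  refine ⟨measurable_seqShift, Measure.eq_infinitePi _ fun s t ht => ?_⟩
  have hpre : seqShift ⁻¹' (Set.pi s t) =
      Set.pi (s.map ⟨Nat.succ, Nat.succ_injective⟩ : Finset ℕ) fun i => t (i - 1) := by
    ext ω
    simp [Set.mem_pi, seqShift]
  rw [Measure.map_apply measurable_seqShift (.pi s.countable_toSet fun i _ => ht i), hpre,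
    bernoulliMeasure, Measure.infinitePi_pi _ fun i _ => ht (i - 1), Finset.prod_map]
  rfl

theorem iIndep_comap_eval (p : PMF ℕ) : ProbabilityTheory.iIndep
    (fun i : ℕ => MeasurableSpace.comap (fun ω : ℕ → ℕ => ω i) inferInstance)
    (bernoulliMeasure p) :=
  ProbabilityTheory.iIndepFun_infinitePi (P := fun _ : ℕ => p.toMeasure) (X := fun _ => id)
    fun _ => measurable_id

/-- An n-fold shift preimage depends only on the coordinates from n on; used for the independence of
the first letter and for Kolmogorov's zero-one law. -/
theorem measurableSet_iSup_comap_preimage_seqShift (n : ℕ) {B : Set (ℕ → ℕ)}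
    (hB : MeasurableSet B) {t : Set ℕ} (ht : ∀ i, n ≤ i → i ∈ t) :
    MeasurableSet[⨆ i ∈ t, MeasurableSpace.comap (fun ω : ℕ → ℕ => ω i) inferInstance]
      (seqShift^[n] ⁻¹' B) := by
  refine (@measurable_pi_iff (ℕ → ℕ) ℕ (fun _ => ℕ)
    (⨆ i ∈ t, MeasurableSpace.comap (fun ω : ℕ → ℕ => ω i) inferInstance) _ _).2 (fun k => ?_) hB
  have h1 : (fun ω : ℕ → ℕ => seqShift^[n] ω k) = fun ω => ω (k + n) := by
    funext ω
    exact seqShift_iterate_apply n ω k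
  rw [h1]
  exact (comap_measurable _).mono
    (le_biSup (fun i => MeasurableSpace.comap (fun ω : ℕ → ℕ => ω i) inferInstance)
      (ht (k + n) (by omega))) le_rfl

theorem bernoulliMeasure_eval_zero (p : PMF ℕ) (a : ℕ) :
    bernoulliMeasure p ((fun ω : ℕ → ℕ => ω 0) ⁻¹' {a}) = p a := by
  rw [← Measure.map_apply (measurable_pi_apply 0) (measurableSet_singleton a), bernoulliMeasure,
    Measure.infinitePi_map_eval, PMF.toMeasure_apply_singleton _ _ (measurableSet_singleton a)]

/-- The first letter is independent of the remaining ones. -/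
theorem bernoulliMeasure_preimage_inter (p : PMF ℕ) (a : ℕ) {B : Set (ℕ → ℕ)}
    (hB : MeasurableSet B) :
    bernoulliMeasure p ((fun ω : ℕ → ℕ => ω 0) ⁻¹' {a} ∩ seqShift ⁻¹' B) =
      p a * bernoulliMeasure p B := by
  have hind := ProbabilityTheory.indep_biSup_compl
    (fun i => (measurable_pi_apply (X := fun _ : ℕ => ℕ) i).comap_le) (iIndep_comap_eval p) {0}
  have h1 : MeasurableSet[⨆ i ∈ ({0} : Set ℕ),
      MeasurableSpace.comap (fun ω : ℕ → ℕ => ω i) inferInstance]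
      ((fun ω : ℕ → ℕ => ω 0) ⁻¹' {a}) := by
    refine le_biSup (fun i => MeasurableSpace.comap (fun ω : ℕ → ℕ => ω i) inferInstance)
      (mem_singleton 0) _ ?_
    exact ⟨{a}, measurableSet_singleton a, rfl⟩
  have h2 := measurableSet_iSup_comap_preimage_seqShift 1 hB (t := {0}ᶜ) (by
    intro i hi
    simp only [mem_compl_iff, mem_singleton_iff]
    omega)
  rw [Function.iterate_one] at h2
  rw [(ProbabilityTheory.Indep_iff _ _ _).1 hind _ _ h1 h2, bernoulliMeasure_eval_zero,
    (measurePreserving_seqShift p).measure_preimage hB.nullMeasurableSet]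

/-- The product of an ergodic transformation with a Bernoulli shift is ergodic. -/
theorem ergodic_prodMap_seqShift {Λ : Type*} [MeasurableSpace Λ] {θ : Λ → Λ} {m : Measure Λ}
    [IsProbabilityMeasure m] (hθ : Ergodic θ m) (p : PMF ℕ) :
    Ergodic (Prod.map θ seqShift) (m.prod (bernoulliMeasure p)) := by
  have hmp := hθ.toMeasurePreserving.prod (measurePreserving_seqShift p)
  refine ⟨hmp, ⟨fun A hA hinv => ?_⟩⟩
  have hsec : ∀ l, MeasurableSet (Prod.mk l ⁻¹' A) := fun l => measurable_prodMk_left hA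
  -- Each fibre of an invariant set is an n-fold shift preimage for every n, hence a tail event, so
  -- its measure is 0 or 1. The base points with full fibre form a θ-invariant set, and ergodicity
  -- of θ finishes.
  have hiter : ∀ (n : ℕ) (l : Λ), Prod.mk l ⁻¹' A = seqShift^[n] ⁻¹' (Prod.mk (θ^[n] l) ⁻¹' A) := by
    intro n l
    have : (Prod.map θ seqShift)^[n] ⁻¹' A = A := by
      induction n with
      | zero => rfl
      | succ n ih => rw [Function.iterate_succ', preimage_comp, hinv, ih]
    conv_lhs => rw [← this]
    rw [Prod.map_iterate]
    rfl
  have h01 : ∀ l, bernoulliMeasure p (Prod.mk l ⁻¹' A) = 0 ∨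
      bernoulliMeasure p (Prod.mk l ⁻¹' A) = 1 := by
    intro l
    refine ProbabilityTheory.measure_zero_or_one_of_measurableSet_limsup_atTop
      (fun i => (measurable_pi_apply (X := fun _ : ℕ => ℕ) i).comap_le) (iIndep_comap_eval p) ?_
    rw [limsup_eq_iInf_iSup_of_nat, MeasurableSpace.measurableSet_iInf]
    intro n
    rw [hiter n l]
    exact measurableSet_iSup_comap_preimage_seqShift n (hsec _) (t := {i | n ≤ i}) fun i hi => hi
  have hB : MeasurableSet {l | bernoulliMeasure p (Prod.mk l ⁻¹' A) = 1} :=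
    measurable_measure_prodMk_left hA (measurableSet_singleton 1)
  have hBinv : θ ⁻¹' {l | bernoulliMeasure p (Prod.mk l ⁻¹' A) = 1} =
      {l | bernoulliMeasure p (Prod.mk l ⁻¹' A) = 1} := by
    ext l
    have := (measurePreserving_seqShift p).measure_preimage (hsec (θ l)).nullMeasurableSet
    have h2 := hiter 1 l
    rw [Function.iterate_one, Function.iterate_one] at h2
    simp only [mem_preimage, mem_ofPred_eq]
    rw [h2, this]
  rw [eventuallyConst_set']
  rcases hθ.toPreErgodic.ae_mem_or_ae_notMem hB hBinv with h | h
  · right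
    rw [ae_eq_univ, Measure.measure_prod_null hA.compl]
    filter_upwards [h] with l hl
    exact (prob_compl_eq_zero_iff (hsec l)).2 hl
  · left
    rw [ae_eq_empty, Measure.measure_prod_null hA]
    filter_upwards [h] with l hl
    exact (h01 l).resolve_right hl

end BernoulliShift

/-! ## Exact dimensionality for affine codings driven by a Bernoulli shift -/

section AffineCoding

variable {Λ : Type*} [MeasurableSpace Λ]

/-- `π l ω` is the coding map, with bounded range, of the random affine maps `x ↦ c e l * x + τ e l`
with ratios in `(0, s]`, `s < 1`. -/
structure IsAffineCoding (θ : Λ → Λ) (c τ : ℕ → Λ → ℝ) (s R : ℝ) (π : Λ → (ℕ → ℕ) → ℝ) :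
    Prop where
  measurable_ratio : ∀ e, Measurable (c e)
  ratio_pos : ∀ e l, 0 < c e l
  ratio_le : ∀ e l, c e l ≤ s
  lt_one : s < 1
  radius_pos : 0 < R
  measurable_coding : Measurable fun z : Λ × (ℕ → ℕ) => π z.1 z.2
  coding_eq : ∀ l ω, π l ω = c (ω 0) l * π (θ l) (seqShift ω) + τ (ω 0) l
  abs_sub_le : ∀ l ω ω', |π l ω - π l ω'| ≤ R

/-- The product of `R` and the contraction ratios along the first `n` letters. -/
noncomputable def codeRadius (θ : Λ → Λ) (c : ℕ → Λ → ℝ) (R : ℝ) : ℕ → Λ × (ℕ → ℕ) → ℝ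
  | 0, _ => R
  | n + 1, z => c (z.2 0) z.1 * codeRadius θ c R n (Prod.map θ seqShift z)

/-- The relative information, given the coding map, of the first letter at the scale of the
cylinder of length `n`. -/
noncomputable def codeInfo (θ : Λ → Λ) (c : ℕ → Λ → ℝ) (R : ℝ) (π : Λ → (ℕ → ℕ) → ℝ) (p : PMF ℕ)
    (n : ℕ) (z : Λ × (ℕ → ℕ)) : ℝ :=
  overlapInfo (bernoulliMeasure p) (π z.1) (fun ω => ω 0) z.2 (codeRadius θ c R n z)

/-- The mass of the ball around the coded point at the scale of the cylinder of length `n`. -/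
noncomputable def codeMass (θ : Λ → Λ) (c : ℕ → Λ → ℝ) (R : ℝ) (π : Λ → (ℕ → ℕ) → ℝ) (p : PMF ℕ)
    (n : ℕ) (z : Λ × (ℕ → ℕ)) : ℝ≥0∞ :=
  (bernoulliMeasure p).map (π z.1) (Metric.closedBall (π z.1 z.2) (codeRadius θ c R n z))

theorem measurable_apply_letter {c : ℕ → Λ → ℝ} (hc : ∀ e, Measurable (c e)) :
    Measurable fun z : Λ × (ℕ → ℕ) => c (z.2 0) z.1 := by
  have h : Measurable fun y : Λ × ℕ => c y.2 y.1 := measurable_from_prod_countable_left hc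
  exact h.comp (measurable_fst.prodMk ((measurable_pi_apply 0).comp measurable_snd))

theorem lintegral_letter (m : Measure Λ) [IsProbabilityMeasure m] (p : PMF ℕ) (g : ℕ → ℝ≥0∞) :
    ∫⁻ z, g (z.2 0) ∂(m.prod (bernoulliMeasure p)) = ∑' a, g a * p a := by
  have hg : Measurable g := measurable_of_countable g
  have hgm : Measurable fun z : Λ × (ℕ → ℕ) => g (z.2 0) :=
    hg.comp ((measurable_pi_apply 0).comp measurable_snd)
  rw [lintegral_prod _ hgm.aemeasurable]
  simp only [lintegral_const, measure_univ, mul_one]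
  have h := lintegral_map (μ := bernoulliMeasure p) hg
    (measurable_pi_apply (X := fun _ : ℕ => ℕ) 0)
  rw [← h, bernoulliMeasure, Measure.infinitePi_map_eval, lintegral_countable']
  simp_rw [PMF.toMeasure_apply_singleton _ _ (measurableSet_singleton _)]

theorem ae_forall_letter_ne_zero (m : Measure Λ) [IsProbabilityMeasure m] (p : PMF ℕ) :
    ∀ᵐ z ∂(m.prod (bernoulliMeasure p)), ∀ k, p (z.2 k) ≠ 0 := by
  refine ae_all_iff.2 fun k => ?_
  have h : ∀ᵐ ω ∂(bernoulliMeasure p), p (ω k) ≠ 0 := by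
    have h1 : ∀ᵐ a ∂((bernoulliMeasure p).map fun ω : ℕ → ℕ => ω k), p a ≠ 0 := by
      rw [bernoulliMeasure, Measure.infinitePi_map_eval, ae_iff,
        PMF.toMeasure_apply_eq_zero_iff _ (MeasurableSet.of_discrete)]
      rw [Set.disjoint_left]
      intro a ha h0
      exact h0 ((PMF.mem_support_iff _ _).1 ha)
    exact ae_of_ae_map (measurable_pi_apply k).aemeasurable h1
  exact Measure.quasiMeasurePreserving_snd.ae h

namespace IsAffineCoding

variable {θ : Λ → Λ} {c τ : ℕ → Λ → ℝ} {s R : ℝ} {π : Λ → (ℕ → ℕ) → ℝ}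

theorem measurable_section (H : IsAffineCoding θ c τ s R π) (l : Λ) : Measurable (π l) :=
  H.measurable_coding.comp measurable_prodMk_left

theorem codeRadius_pos (H : IsAffineCoding θ c τ s R π) (n : ℕ) :
    ∀ z, 0 < codeRadius θ c R n z := by
  induction n with
  | zero => exact fun _ => H.radius_pos
  | succ n ih => exact fun z => mul_pos (H.ratio_pos _ _) (ih _)

theorem codeRadius_le (H : IsAffineCoding θ c τ s R π) (n : ℕ) :
    ∀ z, codeRadius θ c R n z ≤ s ^ n * R := by
  induction n with
  | zero => intro z; simp [codeRadius]
  | succ n ih =>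
    intro z
    calc c (z.2 0) z.1 * codeRadius θ c R n (Prod.map θ seqShift z) ≤ s * (s ^ n * R) :=
          mul_le_mul (H.ratio_le _ _) (ih _) (H.codeRadius_pos _ _).le
            ((H.ratio_pos (z.2 0) z.1).le.trans (H.ratio_le _ _))
      _ = s ^ (n + 1) * R := by ring

theorem codeRadius_antitone (H : IsAffineCoding θ c τ s R π) (z : Λ × (ℕ → ℕ)) :
    Antitone fun n => codeRadius θ c R n z := by
  refine antitone_nat_of_succ_le fun n => ?_
  induction n generalizing z with
  | zero =>
    exact mul_le_of_le_one_left H.radius_pos.le ((H.ratio_le _ _).trans H.lt_one.le)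
  | succ n ih => exact mul_le_mul_of_nonneg_left (ih _) (H.ratio_pos _ _).le

theorem codeRadius_le_radius (H : IsAffineCoding θ c τ s R π) (n : ℕ) (z : Λ × (ℕ → ℕ)) :
    codeRadius θ c R n z ≤ R :=
  H.codeRadius_antitone z n.zero_le

theorem tendsto_codeRadius (H : IsAffineCoding θ c τ s R π) (z : Λ × (ℕ → ℕ)) :
    Tendsto (fun n => codeRadius θ c R n z) atTop (𝓝 0) := by
  have hs0 : 0 ≤ s := (H.ratio_pos 0 z.1).le.trans (H.ratio_le _ _)
  have h := (tendsto_pow_atTop_nhds_zero_of_lt_one hs0 H.lt_one).mul_const R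
  rw [zero_mul] at h
  exact squeeze_zero (fun n => (H.codeRadius_pos n z).le) (fun n => H.codeRadius_le n z) h

theorem neg_log_codeRadius (H : IsAffineCoding θ c τ s R π) (n : ℕ) :
    ∀ z, -Real.log (codeRadius θ c R n z) =
      birkhoffSum (Prod.map θ seqShift) (fun z => -Real.log (c (z.2 0) z.1)) n z +
        -Real.log R := by
  induction n with
  | zero => intro z; simp [codeRadius]
  | succ n ih =>
    intro z
    rw [birkhoffSum_succ', codeRadius, Real.log_mul (H.ratio_pos _ _).ne'
      (H.codeRadius_pos _ _).ne', neg_add, ih]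
    ring

theorem measurable_codeRadius (H : IsAffineCoding θ c τ s R π) (hθ : Measurable θ) (n : ℕ) :
    Measurable (codeRadius θ c R n) := by
  induction n with
  | zero => exact measurable_const
  | succ n ih =>
    exact (measurable_apply_letter H.measurable_ratio).mul
      (ih.comp (hθ.prodMap measurable_seqShift))

/-- Both ball masses are measures of sections of measurable sets of pairs (z, ω'), which gives
measurability jointly in the base point, the centre and the radius. -/
theorem measurable_codeInfo (H : IsAffineCoding θ c τ s R π) (hθ : Measurable θ) (p : PMF ℕ)
    (n : ℕ) : Measurable (codeInfo θ c R π p n) := by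
  have hS : MeasurableSet {y : (Λ × (ℕ → ℕ)) × (ℕ → ℕ) |
      dist (π y.1.1 y.2) (π y.1.1 y.1.2) ≤ codeRadius θ c R n y.1} := by
    refine measurableSet_le (Measurable.dist ?_ ?_)
      ((H.measurable_codeRadius hθ n).comp measurable_fst)
    · exact H.measurable_coding.comp ((measurable_fst.comp measurable_fst).prodMk measurable_snd)
    · exact H.measurable_coding.comp measurable_fst
  have hE : MeasurableSet {y : (Λ × (ℕ → ℕ)) × (ℕ → ℕ) | y.2 0 = y.1.2 0} :=
    measurableSet_eq_fun ((measurable_pi_apply 0).comp measurable_snd)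
      ((measurable_pi_apply 0).comp (measurable_snd.comp measurable_fst))
  have h1 := (measurable_measure_prodMk_left (ν := bernoulliMeasure p) hS).ennreal_toReal
  have h2 := (measurable_measure_prodMk_left (ν := bernoulliMeasure p)
    (hS.inter hE)).ennreal_toReal
  convert! Real.measurable_log.comp (h1.div h2) using 1
  funext z
  simp only [codeInfo, overlapInfo, Function.comp_apply, Pi.div_apply, measureReal_def]
  rw [Measure.map_apply (H.measurable_section _) Metric.isClosed_closedBall.measurableSet,
    Measure.map_apply (H.measurable_section _) Metric.isClosed_closedBall.measurableSet,
    Measure.restrict_apply (H.measurable_section _ Metric.isClosed_closedBall.measurableSet)]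
  rfl

theorem codeInfo_nonneg (H : IsAffineCoding θ c τ s R π) (p : PMF ℕ) (n : ℕ) (z : Λ × (ℕ → ℕ)) :
    0 ≤ codeInfo θ c R π p n z :=
  overlapInfo_nonneg (H.measurable_section _) _ _

/-- Restricting to the first letter rescales the measure of a ball. -/
theorem map_restrict_closedBall (H : IsAffineCoding θ c τ s R π) (p : PMF ℕ) (n : ℕ)
    (z : Λ × (ℕ → ℕ)) :
    ((bernoulliMeasure p).restrict ((fun ω : ℕ → ℕ => ω 0) ⁻¹' {z.2 0})).map (π z.1)
      (Metric.closedBall (π z.1 z.2) (codeRadius θ c R (n + 1) z)) =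
    p (z.2 0) * codeMass θ c R π p n (Prod.map θ seqShift z) := by
  have hball : ∀ (x r : ℝ), MeasurableSet (Metric.closedBall x r) := fun x r =>
    Metric.isClosed_closedBall.measurableSet
  rw [codeMass, Measure.map_apply (H.measurable_section _) (hball _ _),
    Measure.map_apply (H.measurable_section _) (hball _ _),
    Measure.restrict_apply (H.measurable_section _ (hball _ _)),
    ← bernoulliMeasure_preimage_inter p _ (H.measurable_section _ (hball _ _)), inter_comm]
  congr 1
  ext ω
  simp only [mem_inter_iff, mem_preimage, mem_singleton_iff, Metric.mem_closedBall, Real.dist_eq]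
  -- Two codings with the same first letter are images of the shifted codings under one affine map,
  -- so distance and radius scale by the same factor.
  refine and_congr_right fun hω => ?_
  rw [H.coding_eq z.1 ω, H.coding_eq z.1 z.2, hω, add_sub_add_right_eq_sub, ← mul_sub, abs_mul,
    abs_of_pos (H.ratio_pos _ _), codeRadius]
  exact mul_le_mul_iff_right₀ (H.ratio_pos _ _)

theorem codeMass_zero (H : IsAffineCoding θ c τ s R π) (p : PMF ℕ) (z : Λ × (ℕ → ℕ)) :
    codeMass θ c R π p 0 z = 1 := by
  rw [codeMass, Measure.map_apply (H.measurable_section _)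
    Metric.isClosed_closedBall.measurableSet, ← measure_univ (μ := bernoulliMeasure p)]
  congr 1
  refine eq_univ_of_forall fun ω => ?_
  simp only [mem_preimage, Metric.mem_closedBall, Real.dist_eq]
  exact H.abs_sub_le _ _ _

theorem codeMass_ne_top (H : IsAffineCoding θ c τ s R π) (p : PMF ℕ) (n : ℕ) (z : Λ × (ℕ → ℕ)) :
    codeMass θ c R π p n z ≠ ∞ := by
  have := Measure.isProbabilityMeasure_map (μ := bernoulliMeasure p)
    (H.measurable_section z.1).aemeasurable
  exact measure_ne_top _ _

/-- The part carried by the first letter is already positive, by induction through the rescaling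
identity. -/
theorem codeMass_ne_zero (H : IsAffineCoding θ c τ s R π) (p : PMF ℕ) (n : ℕ) :
    ∀ z : Λ × (ℕ → ℕ), (∀ k, p (z.2 k) ≠ 0) → codeMass θ c R π p n z ≠ 0 := by
  induction n with
  | zero => intro z _; rw [H.codeMass_zero]; exact one_ne_zero
  | succ n ih =>
    intro z hz h0
    have hle : ((bernoulliMeasure p).restrict ((fun ω : ℕ → ℕ => ω 0) ⁻¹' {z.2 0})).map (π z.1)
        (Metric.closedBall (π z.1 z.2) (codeRadius θ c R (n + 1) z)) ≤
        codeMass θ c R π p (n + 1) z := map_restrict_le_map (H.measurable_section _) _ _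
    rw [H.map_restrict_closedBall, h0, nonpos_iff_eq_zero, mul_eq_zero] at hle
    exact hle.elim (hz 0) (ih _ fun k => hz (k + 1))

/-- Each step of the rescaling identity reads -log M_{n+1} = -log p(ω_0) - I_{n+1} - log M_n∘F, and
M_0 = 1. The resulting sum pairs the information at level n - k with the k-th iterate, the form
treated by Maker's theorem. -/
theorem neg_log_codeMass (H : IsAffineCoding θ c τ s R π) (p : PMF ℕ) (n : ℕ) :
    ∀ z : Λ × (ℕ → ℕ), (∀ k, p (z.2 k) ≠ 0) → -Real.log (codeMass θ c R π p n z).toReal =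
      birkhoffSum (Prod.map θ seqShift) (fun z => -Real.log (p (z.2 0)).toReal) n z -
        ∑ k ∈ Finset.range n, codeInfo θ c R π p (n - k) ((Prod.map θ seqShift)^[k] z) := by
  induction n with
  | zero => intro z _; simp [H.codeMass_zero]
  | succ n ih =>
    intro z hz
    have hz' : ∀ k, p ((Prod.map θ seqShift z).2 k) ≠ 0 := fun k => hz (k + 1)
    have hp : 0 < (p (z.2 0)).toReal := ENNReal.toReal_pos (hz 0) (PMF.apply_ne_top _ _)
    have hm := ENNReal.toReal_pos (H.codeMass_ne_zero p n _ hz') (H.codeMass_ne_top p n _)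
    have hm1 := ENNReal.toReal_pos (H.codeMass_ne_zero p (n + 1) _ hz)
      (H.codeMass_ne_top p (n + 1) _)
    have hinfo : codeInfo θ c R π p (n + 1) z = Real.log (codeMass θ c R π p (n + 1) z).toReal -
        (Real.log (p (z.2 0)).toReal +
          Real.log (codeMass θ c R π p n (Prod.map θ seqShift z)).toReal) := by
      rw [codeInfo, overlapInfo, measureReal_def, measureReal_def, H.map_restrict_closedBall,
        ENNReal.toReal_mul, Real.log_div _ (mul_pos hp hm).ne', Real.log_mul hp.ne' hm.ne']
      · rfl
      · exact hm1.ne'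
    rw [birkhoffSum_succ', Finset.sum_range_succ']
    simp only [Function.iterate_succ_apply, Function.iterate_zero_apply, Nat.add_sub_add_right,
      Nat.sub_zero]
    rw [hinfo]
    linarith [ih _ hz']

variable {m : Measure Λ}

theorem ae_exists_tendsto_codeInfo (H : IsAffineCoding θ c τ s R π) (hθ : Measurable θ)
    (p : PMF ℕ) : ∀ᵐ z ∂(m.prod (bernoulliMeasure p)),
      ∃ l, Tendsto (fun n => codeInfo θ c R π p n z) atTop (𝓝 l) := by
  rw [Measure.ae_prod_iff_ae_ae (measurableSet_exists_tendsto fun n =>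
    H.measurable_codeInfo hθ p n)]
  refine Eventually.of_forall fun l => ?_
  filter_upwards [ae_exists_tendsto_overlapInfo (ν := bernoulliMeasure p) (H.measurable_section l)
    (measurable_pi_apply (X := fun _ : ℕ => ℕ) 0)] with ω ⟨u, hu⟩
  exact ⟨u, hu.comp (tendsto_nhdsWithin_iff.2 ⟨H.tendsto_codeRadius (l, ω),
    Eventually.of_forall fun n => H.codeRadius_pos n (l, ω)⟩)⟩

variable [IsProbabilityMeasure m]

/-- Fibrewise, the tails from the maximal inequality bound the integral by a constant B that does
not depend on l and is finite because p has finite entropy. All radii are at most R, so one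
application covers every n. -/
theorem lintegral_iSup_codeInfo_ne_top (H : IsAffineCoding θ c τ s R π) (hθ : Measurable θ)
    {p : PMF ℕ} (hp : Summable fun i => Real.negMulLog (p i).toReal) :
    ∫⁻ z, ⨆ n, ENNReal.ofReal (codeInfo θ c R π p n z) ∂(m.prod (bernoulliMeasure p)) ≠ ∞ := by
  obtain ⟨N, hN⟩ := exists_measure_overlapInfo_gt_le
  have hmeas : Measurable fun z => ⨆ n, ENNReal.ofReal (codeInfo θ c R π p n z) :=
    Measurable.iSup fun n => (H.measurable_codeInfo hθ p n).ennreal_ofReal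
  set B : ℝ≥0∞ := ∑' a, (ENNReal.ofReal (Real.negMulLog (p a).toReal) +
    N * p a * ∑' k : ℕ, ENNReal.ofReal (Real.exp (-k))) with hB
  have hBtop : B ≠ ∞ := by
    rw [hB, ENNReal.tsum_add, ENNReal.tsum_mul_right, ENNReal.tsum_mul_left, PMF.tsum_coe]
    refine ENNReal.add_ne_top.2 ⟨hp.tsum_ofReal_ne_top, ?_⟩
    exact ENNReal.mul_ne_top (by simp) Real.summable_exp_neg_nat.tsum_ofReal_ne_top
  rw [lintegral_prod _ hmeas.aemeasurable]
  refine ne_top_of_le_ne_top hBtop ?_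
  calc _ ≤ ∫⁻ _l, B ∂m := lintegral_mono fun l => ?_
    _ = B := by simp
  have h := lintegral_le_of_exponential_tails (ν := bernoulliMeasure p)
    (measurable_pi_apply (X := fun _ : ℕ => ℕ) 0) (hmeas.comp (measurable_prodMk_left (x := l)))
    (C := N)
    (fun a u hu => (measure_mono ?_).trans
      (hN (bernoulliMeasure p) (H.measurable_section l)
        (measurable_pi_apply (X := fun _ : ℕ => ℕ) 0) R u hu a))
  · simp only [measureReal_def, bernoulliMeasure_eval_zero] at h
    exact h
  · refine inter_subset_inter_right _ fun ω hω => ?_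
    obtain ⟨n, hn⟩ := lt_iSup_iff.1 (show ENNReal.ofReal u < ⨆ n, _ from hω)
    exact ⟨_, H.codeRadius_pos n _, H.codeRadius_le_radius n _,
      (ENNReal.ofReal_lt_ofReal_iff'.1 hn).1⟩

/-- The exponential decay rate of the masses of balls at the scales of the cylinders. -/
theorem exists_tendsto_neg_log_codeMass_div (H : IsAffineCoding θ c τ s R π) (hθ : Ergodic θ m)
    {p : PMF ℕ} (hp : Summable fun i => Real.negMulLog (p i).toReal) :
    ∃ h : ℝ, 0 ≤ h ∧ h ≤ ∑' i, Real.negMulLog (p i).toReal ∧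
      ∀ᵐ z ∂(m.prod (bernoulliMeasure p)), Tendsto
        (fun n : ℕ => -Real.log (codeMass θ c R π p n z).toReal / n) atTop (𝓝 h) := by
  have hθm := hθ.toMeasurePreserving.measurable
  have hF := ergodic_prodMap_seqShift hθ p
  have hmeas : Measurable fun z => ⨆ n, ENNReal.ofReal (codeInfo θ c R π p n z) :=
    Measurable.iSup fun n => (H.measurable_codeInfo hθm p n).ennreal_ofReal
  have hfin := H.lintegral_iSup_codeInfo_ne_top (m := m) hθm hp
  obtain ⟨U, hUm, hU⟩ := measurable_limit_of_tendsto_metrizable_ae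
    (fun n => (H.measurable_codeInfo hθm p n).aemeasurable)
    (H.ae_exists_tendsto_codeInfo (m := m) hθm p)
  have hdom : ∀ᵐ z ∂(m.prod (bernoulliMeasure p)), ∀ n, |codeInfo θ c R π p n z| ≤
      (⨆ n, ENNReal.ofReal (codeInfo θ c R π p n z)).toReal := by
    filter_upwards [ae_lt_top hmeas hfin] with z hz n
    rw [abs_of_nonneg (H.codeInfo_nonneg p n z), ← ENNReal.ofReal_le_iff_le_toReal hz.ne]
    exact le_iSup (fun n => ENNReal.ofReal (codeInfo θ c R π p n z)) n
  -- Maker's theorem, with the limit U of the informations and their supremum as dominating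
  -- function. Since U ≥ 0, the rate obtained is at most the entropy of p.
  obtain ⟨hUi, hUlim⟩ := hF.ae_tendsto_sum_div_of_dominated (H.measurable_codeInfo hθm p) hUm
    hmeas.ennreal_toReal (integrable_toReal_of_lintegral_ne_top hmeas.aemeasurable hfin) hdom hU
  have hU0 : 0 ≤ ∫ z, U z ∂(m.prod (bernoulliMeasure p)) := by
    refine integral_nonneg_of_ae ?_
    filter_upwards [hU] with z hz using ge_of_tendsto' hz fun n => H.codeInfo_nonneg p n z
  have hpn : ∀ a, 0 ≤ -Real.log (p a).toReal := fun a => neg_nonneg.2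
    (Real.log_nonpos ENNReal.toReal_nonneg (ENNReal.toReal_le_of_le_ofReal zero_le_one
      (by simpa using p.coe_le_one a)))
  have hgm : Measurable fun z : Λ × (ℕ → ℕ) => -Real.log (p (z.2 0)).toReal :=
    (measurable_of_countable fun a => -Real.log (p a).toReal).comp
      ((measurable_pi_apply 0).comp measurable_snd)
  have hgint : ∫⁻ z, ENNReal.ofReal (-Real.log (p (z.2 0)).toReal)
      ∂(m.prod (bernoulliMeasure p)) = ENNReal.ofReal (∑' i, Real.negMulLog (p i).toReal) := by
    rw [lintegral_letter m p fun a => ENNReal.ofReal (-Real.log (p a).toReal),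
      ENNReal.ofReal_tsum_of_nonneg (fun a => ?_) hp]
    · refine tsum_congr fun a => ?_
      rw [Real.negMulLog, neg_mul_comm, ENNReal.ofReal_mul ENNReal.toReal_nonneg,
        ENNReal.ofReal_toReal (PMF.apply_ne_top _ _), mul_comm]
    · rw [Real.negMulLog, neg_mul_comm]
      exact mul_nonneg ENNReal.toReal_nonneg (hpn a)
  have hgi : Integrable (fun z : Λ × (ℕ → ℕ) => -Real.log (p (z.2 0)).toReal)
      (m.prod (bernoulliMeasure p)) := by
    refine ⟨hgm.aestronglyMeasurable, ?_⟩
    rw [hasFiniteIntegral_iff_ofReal (Eventually.of_forall fun z => hpn _), hgint]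
    exact ENNReal.ofReal_lt_top
  have hgval : ∫ z, -Real.log (p (z.2 0)).toReal ∂(m.prod (bernoulliMeasure p)) =
      ∑' i, Real.negMulLog (p i).toReal := by
    rw [integral_eq_lintegral_of_nonneg_ae (Eventually.of_forall fun z => hpn _)
      hgm.aestronglyMeasurable, hgint, ENNReal.toReal_ofReal]
    refine tsum_nonneg fun a => ?_
    rw [Real.negMulLog, neg_mul_comm]
    exact mul_nonneg ENNReal.toReal_nonneg (hpn a)
  have hlim : ∀ᵐ z ∂(m.prod (bernoulliMeasure p)), Tendsto
      (fun n : ℕ => -Real.log (codeMass θ c R π p n z).toReal / n) atTop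
      (𝓝 (∑' i, Real.negMulLog (p i).toReal - ∫ z, U z ∂(m.prod (bernoulliMeasure p)))) := by
    filter_upwards [hUlim, hF.ae_tendsto_birkhoffAverage hgm hgi, ae_forall_letter_ne_zero m p]
      with z h1 h2 h3
    rw [hgval] at h2
    refine (h2.sub h1).congr fun n => ?_
    rw [H.neg_log_codeMass p n z h3, sub_div, birkhoffAverage_real_eq]
  refine ⟨_, ?_, sub_le_self _ hU0, hlim⟩
  obtain ⟨z, hz⟩ := hlim.exists
  refine ge_of_tendsto' hz fun n => div_nonneg (neg_nonneg.2 ?_) n.cast_nonneg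
  have := Measure.isProbabilityMeasure_map (μ := bernoulliMeasure p)
    (H.measurable_section z.1).aemeasurable
  exact Real.log_nonpos measureReal_nonneg measureReal_le_one

/-- The projection of a Bernoulli measure under an affine coding over an ergodic base has almost
everywhere constant pointwise dimension, at most the entropy over the Lyapunov exponent. -/
theorem exists_ae_hasPointwiseDim (H : IsAffineCoding θ c τ s R π) (hθ : Ergodic θ m)
    {p : PMF ℕ} (hp : Summable fun i => Real.negMulLog (p i).toReal) :
    ∃ d : ℝ, 0 ≤ d ∧ (d : EReal) ≤ ((∑' i, Real.negMulLog (p i).toReal : ℝ) : EReal) /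
        ((∫⁻ z, ENNReal.ofReal (-Real.log (c (z.2 0) z.1)) ∂(m.prod (bernoulliMeasure p)) : ℝ≥0∞) :
          EReal) ∧
      ∀ᵐ z ∂(m.prod (bernoulliMeasure p)),
        HasPointwiseDim ((bernoulliMeasure p).map (π z.1)) (π z.1 z.2) (ENNReal.ofReal d) := by
  have hθm := hθ.toMeasurePreserving.measurable
  have hF := ergodic_prodMap_seqShift hθ p
  obtain ⟨h, hh0, hhle, hh⟩ := H.exists_tendsto_neg_log_codeMass_div hθ hp
  have hLm : Measurable fun z : Λ × (ℕ → ℕ) => -Real.log (c (z.2 0) z.1) :=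
    (Real.measurable_log.comp (measurable_apply_letter H.measurable_ratio)).neg
  have hLpos : ∀ z : Λ × (ℕ → ℕ), 0 < -Real.log (c (z.2 0) z.1) := fun z =>
    neg_pos.2 (Real.log_neg (H.ratio_pos _ _) ((H.ratio_le _ _).trans_lt H.lt_one))
  have hprob : ∀ l, IsProbabilityMeasure ((bernoulliMeasure p).map (π l)) := fun l =>
    Measure.isProbabilityMeasure_map (H.measurable_section l).aemeasurable
  have hR : Tendsto (fun n : ℕ => -Real.log R / n) atTop (𝓝 0) :=
    tendsto_const_div_atTop_nhds_zero_nat _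
  have hrad : ∀ (n : ℕ) z, -Real.log (codeRadius θ c R n z) / n =
      birkhoffAverage ℝ (Prod.map θ seqShift) (fun z => -Real.log (c (z.2 0) z.1)) n z +
        -Real.log R / n := fun n z => by
    rw [H.neg_log_codeRadius, add_div, birkhoffAverage_real_eq]
  by_cases htop : ∫⁻ z, ENNReal.ofReal (-Real.log (c (z.2 0) z.1))
      ∂(m.prod (bernoulliMeasure p)) = ∞
  -- With infinite Lyapunov exponent the quotient is 0 in `EReal`, matching d = 0.
  · refine ⟨0, le_rfl, by simp [htop], ?_⟩
    filter_upwards [hh, hF.ae_tendsto_birkhoffAverage_atTop hLm (fun z => (hLpos z).le) htop,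
      ae_forall_letter_ne_zero m p] with z h1 h2 h3
    rw [ENNReal.ofReal_zero]
    refine hasPointwiseDim_zero_of_tendsto_div _ _ (fun n => H.codeRadius_pos n z)
      (H.codeRadius_antitone z) (H.tendsto_codeRadius z) (fun n => H.codeMass_ne_zero p n z h3) h1 ?_
    simp only [hrad]
    exact h2.atTop_add hR
  · have hLi : Integrable (fun z : Λ × (ℕ → ℕ) => -Real.log (c (z.2 0) z.1))
        (m.prod (bernoulliMeasure p)) := by
      refine ⟨hLm.aestronglyMeasurable, ?_⟩
      rw [hasFiniteIntegral_iff_ofReal (Eventually.of_forall fun z => (hLpos z).le)]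
      exact lt_top_iff_ne_top.2 htop
    have hχ : 0 < ∫ z, -Real.log (c (z.2 0) z.1) ∂(m.prod (bernoulliMeasure p)) := by
      rw [integral_pos_iff_support_of_nonneg (fun z => (hLpos z).le) hLi,
        show Function.support (fun z : Λ × (ℕ → ℕ) => -Real.log (c (z.2 0) z.1)) = univ from
          eq_univ_of_forall fun z => (hLpos z).ne', measure_univ]
      exact one_pos
    refine ⟨_, div_nonneg hh0 hχ.le, ?_, ?_⟩
    · rw [← ofReal_integral_eq_lintegral_ofReal hLi (Eventually.of_forall fun z => (hLpos z).le),
        EReal.coe_ennreal_ofReal, max_eq_left hχ.le, ← EReal.coe_div, EReal.coe_le_coe_iff]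
      exact div_le_div_of_nonneg_right hhle hχ.le
    · filter_upwards [hh, hF.ae_tendsto_birkhoffAverage hLm hLi,
        ae_forall_letter_ne_zero m p] with z h1 h2 h3
      refine hasPointwiseDim_of_tendsto_div _ _ (fun n => H.codeRadius_pos n z)
        (H.codeRadius_antitone z) (H.tendsto_codeRadius z) (fun n => H.codeMass_ne_zero p n z h3) hχ
        h1 ?_
      simp only [hrad]
      simpa only [add_zero] using h2.add hR

end IsAffineCoding

end AffineCoding

/-! ## The system of maps `x ↦ l ρ_n x ± 1` -/

section RandomSystem

variable {ε : ℝ} {ρ : ℕ → ℝ} {s a b : ℝ}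

theorem pmMap_eq (e : ℕ) (l : Icc (1 - ε) (1 + ε)) (x : ℝ) :
    pmMap ρ e l x = ((l : ℝ) * ρ (e / 2)) * x + (-1) ^ e := rfl

theorem measurable_randComp_pmMap {θ : Icc (1 - ε) (1 + ε) → Icc (1 - ε) (1 + ε)}
    (hθ : Measurable θ) (x : ℝ) (n : ℕ) :
    Measurable fun z : Icc (1 - ε) (1 + ε) × (ℕ → ℕ) => randComp θ (pmMap ρ) n z.1 z.2 x := by
  induction n with
  | zero => exact measurable_const
  | succ n ih =>
    have h1 : Measurable fun z : Icc (1 - ε) (1 + ε) × (ℕ → ℕ) =>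
        randComp θ (pmMap ρ) n (θ z.1) (seqShift z.2) x :=
      ih.comp (hθ.prodMap measurable_seqShift)
    have h2 : Measurable fun z : Icc (1 - ε) (1 + ε) × (ℕ → ℕ) => (z.1 : ℝ) * ρ (z.2 0 / 2) :=
      measurable_apply_letter (c := fun e (l : Icc (1 - ε) (1 + ε)) => (l : ℝ) * ρ (e / 2)) fun e =>
        measurable_subtype_coe.mul_const _
    have h3 : Measurable fun z : Icc (1 - ε) (1 + ε) × (ℕ → ℕ) => (-1 : ℝ) ^ z.2 0 :=
      measurable_apply_letter (c := fun e _ => (-1 : ℝ) ^ e) fun e => measurable_const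
    exact (h2.mul h1).add h3

theorem isAffineCoding_codingMap (hε1 : ε < 1) (hρ : ∀ n, 0 < ρ n ∧ ρ n < 1) (hs : s < 1)
    (hρs : ∀ n, (1 + ε) * ρ n ≤ s) (hab : a < b)
    (hX : ∀ (e : ℕ) (l : Icc (1 - ε) (1 + ε)), MapsTo (pmMap ρ e l) (Icc a b) (Icc a b))
    {θ : Icc (1 - ε) (1 + ε) → Icc (1 - ε) (1 + ε)} (hθ : Measurable θ) :
    IsAffineCoding θ (fun e l => (l : ℝ) * ρ (e / 2)) (fun e _ => (-1) ^ e) s (b - a)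
      (codingMap θ (pmMap ρ) (Icc a b)) := by
  have hpos : ∀ (e : ℕ) (l : Icc (1 - ε) (1 + ε)), 0 < (l : ℝ) * ρ (e / 2) := fun e l =>
    mul_pos ((sub_pos.2 hε1).trans_le l.2.1) (hρ _).1
  have hle : ∀ (e : ℕ) (l : Icc (1 - ε) (1 + ε)), (l : ℝ) * ρ (e / 2) ≤ s := fun e l =>
    (mul_le_mul_of_nonneg_right l.2.2 (hρ _).1.le).trans (hρs _)
  have hcontr : ∀ (e : ℕ) (l : Icc (1 - ε) (1 + ε)), ∀ x ∈ Icc a b, ∀ y ∈ Icc a b,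
      |pmMap ρ e l x - pmMap ρ e l y| ≤ s * |x - y| := by
    intro e l x _ y _
    rw [pmMap_eq, pmMap_eq, add_sub_add_right_eq_sub, ← mul_sub, abs_mul, abs_of_pos (hpos e l)]
    exact mul_le_mul_of_nonneg_right (hle e l) (abs_nonneg _)
  have hs0 : ∀ l : Icc (1 - ε) (1 + ε), 0 ≤ s := fun l => (hpos 0 l).le.trans (hle 0 l)
  have hinter : ∀ l ω, ⋂ n : ℕ, randComp θ (pmMap ρ) (n + 1) l ω '' Icc a b =
      {codingMap θ (pmMap ρ) (Icc a b) l ω} := fun l ω =>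
    iInter_image_randComp θ (pmMap ρ) (hs0 l) hs isCompact_Icc ⟨a, left_mem_Icc.2 hab.le⟩ hX hcontr
      l ω
  have hmem : ∀ l ω n, codingMap θ (pmMap ρ) (Icc a b) l ω ∈
      randComp θ (pmMap ρ) (n + 1) l ω '' Icc a b := fun l ω =>
    mem_iInter.1 ((hinter l ω).symm ▸ mem_singleton _)
  have hIcc : ∀ l ω, codingMap θ (pmMap ρ) (Icc a b) l ω ∈ Icc a b := by
    intro l ω
    obtain ⟨x, hx, hxe⟩ := hmem l ω 0
    rw [← hxe]
    exact mapsTo_randComp θ (pmMap ρ) hX 1 l ω hx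
  refine ⟨fun e => measurable_subtype_coe.mul_const _, hpos, hle, hs, sub_pos.2 hab, ?_, ?_, ?_⟩
  -- The coding map is the pointwise limit of the finite compositions evaluated at the endpoint a,
  -- which are jointly measurable.
  · refine measurable_of_tendsto_metrizable
      (fun n => measurable_randComp_pmMap (ρ := ρ) hθ a (n + 1)) (tendsto_pi_nhds.2 fun z => ?_)
    rw [tendsto_iff_dist_tendsto_zero]
    have hpow : Tendsto (fun n : ℕ => s ^ (n + 1) * (b - a)) atTop (𝓝 (0 * (b - a))) :=
      ((tendsto_pow_atTop_nhds_zero_of_lt_one (hs0 z.1) hs).comp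
        (tendsto_add_atTop_nat 1)).mul_const _
    rw [zero_mul] at hpow
    refine squeeze_zero (fun n => dist_nonneg) (fun n => ?_) hpow
    obtain ⟨x, hx, hxe⟩ := hmem z.1 z.2 n
    rw [← hxe, Real.dist_eq]
    refine (randComp_contract θ (pmMap ρ) (hs0 z.1) hX hcontr (n + 1) z.1 z.2 a
      (left_mem_Icc.2 hab.le) x hx).trans
        (mul_le_mul_of_nonneg_left ?_ (pow_nonneg (hs0 z.1) _))
    rw [abs_sub_comm, abs_of_nonneg (sub_nonneg.2 hx.1)]
    linarith [hx.2]
  · intro l ω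
    -- The equivariance follows from uniqueness: the image of the shifted coding point lies in all
    -- the nested sets that define the coding point.
    have h1 : pmMap ρ (ω 0) l (codingMap θ (pmMap ρ) (Icc a b) (θ l) (seqShift ω)) ∈
        ⋂ n : ℕ, randComp θ (pmMap ρ) (n + 1) l ω '' Icc a b := by
      refine mem_iInter.2 fun n => ?_
      rcases n with _ | n
      · exact ⟨_, hIcc (θ l) (seqShift ω), rfl⟩
      · obtain ⟨x, hx, hxe⟩ := hmem (θ l) (seqShift ω) n
        exact ⟨x, hx, congrArg (pmMap ρ (ω 0) l) hxe⟩
    rw [hinter l ω] at h1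
    exact (mem_singleton_iff.1 h1).symm
  · intro l ω ω'
    have h1 := hIcc l ω
    have h2 := hIcc l ω'
    rw [abs_le]
    constructor <;> linarith [h1.1, h1.2, h2.1, h2.2]

theorem integrable_log_coe (hε1 : ε < 1) (m : Measure (Icc (1 - ε) (1 + ε))) [IsFiniteMeasure m] :
    Integrable (fun l : Icc (1 - ε) (1 + ε) => Real.log (l : ℝ)) m := by
  refine Integrable.of_bound (Real.measurable_log.comp measurable_subtype_coe).aestronglyMeasurable
    (|Real.log (1 - ε)| + |Real.log (1 + ε)|) (Eventually.of_forall fun l => ?_)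
  have h1 : 0 < 1 - ε := sub_pos.2 hε1
  have h2 := Real.log_le_log h1 l.2.1
  have h3 := Real.log_le_log (h1.trans_le l.2.1) l.2.2
  rw [Real.norm_eq_abs, abs_le]
  constructor
  · linarith [neg_abs_le (Real.log (1 - ε)), abs_nonneg (Real.log (1 + ε))]
  · linarith [le_abs_self (Real.log (1 + ε)), abs_nonneg (Real.log (1 - ε))]

theorem lintegral_neg_log_rho (m : Measure (Icc (1 - ε) (1 + ε))) [IsProbabilityMeasure m]
    (p : PMF ℕ) (ρ : ℕ → ℝ) :
    ∫⁻ z, ENNReal.ofReal (-Real.log (ρ (z.2 0 / 2))) ∂(m.prod (bernoulliMeasure p)) =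
      ∑' i : ℕ, (p (2 * i) + p (2 * i + 1)) * ENNReal.ofReal (-Real.log (ρ i)) := by
  rw [lintegral_letter m p fun a => ENNReal.ofReal (-Real.log (ρ (a / 2))),
    ← tsum_even_add_odd ENNReal.summable ENNReal.summable, ← ENNReal.tsum_add]
  refine tsum_congr fun i => ?_
  rw [Nat.mul_div_cancel_left i two_pos, show (2 * i + 1) / 2 = i by omega]
  ring

/-- The Lyapunov exponent is the integral of minus the logarithm of the contraction ratio. -/
theorem lyapunovExponent_eq (hε1 : ε < 1) (hρ : ∀ n, 0 < ρ n ∧ ρ n < 1) (hs : s < 1)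
    (hρs : ∀ n, (1 + ε) * ρ n ≤ s) (m : Measure (Icc (1 - ε) (1 + ε))) [IsProbabilityMeasure m]
    (p : PMF ℕ) :
    lyapunovExponent m p ρ = ((∫⁻ z, ENNReal.ofReal (-Real.log ((z.1 : ℝ) * ρ (z.2 0 / 2)))
      ∂(m.prod (bernoulliMeasure p)) : ℝ≥0∞) : EReal) := by
  set μ := m.prod (bernoulliMeasure p)
  have hlpos : ∀ l : Icc (1 - ε) (1 + ε), 0 < (l : ℝ) := fun l => (sub_pos.2 hε1).trans_le l.2.1
  have hL : ∀ z : Icc (1 - ε) (1 + ε) × (ℕ → ℕ), -Real.log ((z.1 : ℝ) * ρ (z.2 0 / 2)) =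
      -Real.log z.1 + -Real.log (ρ (z.2 0 / 2)) := fun z => by
    rw [Real.log_mul (hlpos _).ne' (hρ _).1.ne', neg_add]
  have hL0 : ∀ z : Icc (1 - ε) (1 + ε) × (ℕ → ℕ), 0 ≤ -Real.log ((z.1 : ℝ) * ρ (z.2 0 / 2)) :=
    fun z => neg_nonneg.2 (Real.log_nonpos (mul_pos (hlpos _) (hρ _).1).le
      (((mul_le_mul_of_nonneg_right z.1.2.2 (hρ _).1.le).trans (hρs _)).trans hs.le))
  have hρ0 : ∀ n, 0 ≤ -Real.log (ρ n) := fun n =>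
    neg_nonneg.2 (Real.log_nonpos (hρ n).1.le (hρ n).2.le)
  have hlm : Integrable (fun z : Icc (1 - ε) (1 + ε) × (ℕ → ℕ) => -Real.log (z.1 : ℝ)) μ :=
    (integrable_log_coe hε1 m).neg.comp_fst _
  have hlint : ∫ z, -Real.log (z.1 : ℝ) ∂μ = -∫ l, Real.log (l : ℝ) ∂m := by
    rw [integral_neg, neg_inj]
    have := integral_fun_fst (μ := m) (ν := bernoulliMeasure p) fun l => Real.log (l : ℝ)
    simpa using this
  have hρm : Measurable fun z : Icc (1 - ε) (1 + ε) × (ℕ → ℕ) => -Real.log (ρ (z.2 0 / 2)) :=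
    measurable_apply_letter (c := fun e _ => -Real.log (ρ (e / 2))) fun _ => measurable_const
  rw [lyapunovExponent, ← lintegral_neg_log_rho m p ρ, ← hlint]
  -- Since -log λ may be negative, the lower integrals cannot simply be added. In the infinite case,
  -- integrability of log λ prevents cancellation; otherwise everything is integrable and Bochner
  -- integrals add.
  by_cases htop : ∫⁻ z, ENNReal.ofReal (-Real.log (ρ (z.2 0 / 2))) ∂μ = ∞
  · have h2 : ∫⁻ z, ENNReal.ofReal (-Real.log ((z.1 : ℝ) * ρ (z.2 0 / 2))) ∂μ = ∞ := by
      by_contra hfin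
      have hle : ∫⁻ z, ENNReal.ofReal (-Real.log (ρ (z.2 0 / 2))) ∂μ ≤
          ∫⁻ z, ENNReal.ofReal (-Real.log ((z.1 : ℝ) * ρ (z.2 0 / 2))) ∂μ +
            ∫⁻ z, ENNReal.ofReal |(-Real.log (z.1 : ℝ))| ∂μ := by
        rw [← lintegral_add_right' _ hlm.aemeasurable.abs.ennreal_ofReal]
        refine lintegral_mono fun z => ?_
        rw [← ENNReal.ofReal_add (hL0 z) (abs_nonneg _)]
        refine ENNReal.ofReal_le_ofReal ?_
        rw [hL z]
        linarith [neg_abs_le (-Real.log (z.1 : ℝ))]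
      rw [htop, top_le_iff, ENNReal.add_eq_top] at hle
      refine hle.elim hfin fun h => ?_
      have := hlm.abs.lintegral_lt_top
      exact this.ne h
    rw [htop, h2, EReal.coe_ennreal_top, EReal.coe_add_top]
  · have hρi : Integrable (fun z : Icc (1 - ε) (1 + ε) × (ℕ → ℕ) => -Real.log (ρ (z.2 0 / 2))) μ := by
      refine ⟨hρm.aestronglyMeasurable, ?_⟩
      rw [hasFiniteIntegral_iff_ofReal (Eventually.of_forall fun z => hρ0 _)]
      exact lt_top_iff_ne_top.2 htop
    have hsum : Integrable (fun z : Icc (1 - ε) (1 + ε) × (ℕ → ℕ) =>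
        -Real.log ((z.1 : ℝ) * ρ (z.2 0 / 2))) μ := by
      simp only [hL]
      exact hlm.add hρi
    rw [← ofReal_integral_eq_lintegral_ofReal hρi (Eventually.of_forall fun z => hρ0 _),
      ← ofReal_integral_eq_lintegral_ofReal hsum (Eventually.of_forall hL0),
      EReal.coe_ennreal_ofReal, EReal.coe_ennreal_ofReal, max_eq_left (integral_nonneg fun z => hρ0 _),
      max_eq_left (integral_nonneg hL0), ← EReal.coe_add, ← integral_add hlm hρi]
    simp only [hL]

end RandomSystem

/-- The constant kernel disintegrates a product measure, and disintegrations are almost everywhere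
unique. -/
theorem condKernel_prod_ae_eq {Λ Ω : Type*} [MeasurableSpace Λ] [MeasurableSpace Ω]
    [StandardBorelSpace Ω] [Nonempty Ω] (m : Measure Λ) [IsProbabilityMeasure m] (ν : Measure Ω)
    [IsProbabilityMeasure ν] : ∀ᵐ l ∂m, (m.prod ν).condKernel l = ν := by
  have h := ProbabilityTheory.eq_condKernel_of_measure_eq_compProd (ρ := m.prod ν) (ProbabilityTheory.Kernel.const Λ ν)
    (by rw [Measure.fst_prod, Measure.compProd_const])
  rw [Measure.fst_prod] at h
  filter_upwards [h] with l hl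
  rw [← hl, ProbabilityTheory.Kernel.const_apply]

theorem mainTheorem8
    (ε : ℝ) (hε0 : 0 < ε) (hε1 : ε < 1)
    (ρ : ℕ → ℝ) (hρ : ∀ n, 0 < ρ n ∧ ρ n < 1)
    -- a common bound `s < 1` for the contraction ratios
    (s : ℝ) (hs : s < 1) (hρs : ∀ n, (1 + ε) * ρ n ≤ s)
    -- the compact interval `X = [a, b]` on which the maps act
    (a b : ℝ) (hab : a < b)
    (hX : ∀ (e : ℕ) (l : Icc (1 - ε) (1 + ε)), MapsTo (pmMap ρ e l) (Icc a b) (Icc a b))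
    -- the base dynamics
    (θ : Icc (1 - ε) (1 + ε) ≃ᵐ Icc (1 - ε) (1 + ε))
    (m : Measure (Icc (1 - ε) (1 + ε))) [IsProbabilityMeasure m]
    (hm : m.map Subtype.val ≪ (volume : Measure ℝ))
    (hθ : Ergodic θ m)
    -- the probability vector of the Bernoulli measure, of finite entropy
    (p : PMF ℕ) (hp : Summable fun i => Real.negMulLog (p i).toReal)
    -- the measure `m × ν`
    (μ : Measure (Icc (1 - ε) (1 + ε) × (ℕ → ℕ))) [IsFiniteMeasure μ]
    (hμ : μ = m.prod (bernoulliMeasure p)) :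
    ∀ᵐ z ∂μ, ∃ d : ℝ≥0∞,
      HasPointwiseDim
        ((μ.condKernel z.1).map (codingMap θ (pmMap ρ) (Icc a b) z.1))
        (codingMap θ (pmMap ρ) (Icc a b) z.1 z.2) d ∧
      HasHausdorffDim
        ((μ.condKernel z.1).map (codingMap θ (pmMap ρ) (Icc a b) z.1)) d ∧
      (d : EReal) ≤
        ((ksEntropy m θ : EReal) + ((∑' i, Real.negMulLog (p i).toReal : ℝ) : EReal)) /
          lyapunovExponent m p ρ := by
  subst hμ
  have H := isAffineCoding_codingMap hε1 hρ hs hρs hab hX θ.measurable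
  obtain ⟨d, hd0, hdle, hd⟩ := H.exists_ae_hasPointwiseDim hθ hp
  have hcond : ∀ᵐ z ∂(m.prod (bernoulliMeasure p)),
      (m.prod (bernoulliMeasure p)).condKernel z.1 = bernoulliMeasure p :=
    Measure.quasiMeasurePreserving_fst.ae (condKernel_prod_ae_eq m (bernoulliMeasure p))
  -- The Hausdorff dimension over z.1 requires the pointwise dimension at almost every point of that
  -- whole fibre, not only at z.2; this comes from Fubini.
  have hHD : ∀ᵐ z ∂(m.prod (bernoulliMeasure p)), ∀ᵐ ω ∂(bernoulliMeasure p),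
      HasPointwiseDim ((bernoulliMeasure p).map (codingMap θ (pmMap ρ) (Icc a b) z.1))
        (codingMap θ (pmMap ρ) (Icc a b) z.1 ω) (ENNReal.ofReal d) :=
    Measure.quasiMeasurePreserving_fst.ae (Measure.ae_ae_of_ae_prod hd)
  filter_upwards [hd, hcond, hHD] with z h1 h2 h3
  rw [h2]
  refine ⟨ENNReal.ofReal d, h1,
    hasHausdorffDim_of_ae_hasPointwiseDim _ (H.measurable_section z.1) hd0 h3, ?_⟩
  rw [EReal.coe_ennreal_ofReal, max_eq_left hd0, lyapunovExponent_eq hε1 hρ hs hρs m p]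
  -- Adding the nonnegative entropy of the base only enlarges the numerator over a nonnegative
  -- denominator.
  refine hdle.trans (EReal.div_le_div_right_of_nonneg (EReal.coe_ennreal_nonneg _) ?_)
  exact le_add_of_nonneg_left (EReal.coe_ennreal_nonneg _)
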